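/- Write $[n]=\{1,\dots,n\}$, with indices taken modulo $n$. A matroid $M$ on $[n]$ is a \emph{positroid} if there is a real $d\times n$ matrix $A$ of rank $d$, all of whose $d\times d$ minors are nonnegative, such that the bases of $M$ are exactly the sets $B\subseteq[n]$ for which the columns of $A$ indexed by $B$ form a basis of $\mathbb{R}^d$. A matroid is \emph{connected} if it is not the direct sum of two nonempty matroids. Let $\Pi_M$ be the set of ground sets of the connected components of $M$ (its nonempty connected direct summands). A partition of $[n]$ is \emph{non-crossing} if there are no $a,b,c,d$ in cyclic order such that $a,c$ lie in one block and $b,d$ lie in a different block. For $k\in[n]$ let $I_k$ be the lexicographically minimal basis of $M$ with respect to the order $k<_k k+1<_k\cdots<_k n<_k 1<_k\cdots<_k k-1$. The \emph{decorated permutation} of $M$ is the permutation $\pi$ of $[n]$, with fixed points coloured clockwise or counterclockwise, determined as follows for each $i\in[n]$: if $i\in I_i$ and $I_{i+1}=(I_i\setminus\{i\})\cup\{j\}$ with $j\ne i$, then $\pi(j)=i$; if $I_{i+1}=I_i$ and $i\notin I_i$, then $i$ is a clockwise fixed point; if $I_{i+1}=I_i$ and $i\in I_i$, then $i$ is a counterclockwise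 fixed point. The \emph{chord diagram} of $\pi$ is the union of the straight segments joining vertex $i$ to vertex $\pi(i)$ for $i\in[n]$, where the vertices $1,\dots,n$ are placed equally spaced in clockwise order on a circle. \textbf{Statement.} Let $M$ be a positroid on $[n]$ with decorated permutation $\pi$. Then $\Pi_M$ is the finest non-crossing partition of $[n]$ in which, for every $i\in[n]$, the elements $i$ and $\pi(i)$ lie in the same block; that is, $\Pi_M$ is a non-crossing partition of $[n]$ with this property, and it refines every non-crossing partition of $[n]$ with this property. Moreover, the blocks of $\Pi_M$ are exactly the sets of vertices lying in a common connected component of the chord diagram of $\pi$. -/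

import Mathlib

open Set

namespace Positroid

/-! Throughout, `Fin n` plays the role of `[n]`, and the cyclic successor `i + 1` of `i` (with
`n + 1 = 1`) is `finRotate n i`. -/

/-! ### Positroids -/

/-- `M` is the matroid `M(A)` on `[n]`: its bases are the sets `B` for which the columns of `A`
indexed by `B` form a linear basis of `ℝ ^ d`. -/
def IsMatroidOf {n d : ℕ} (M : Matroid (Fin n)) (A : Matrix (Fin d) (Fin n) ℝ) : Prop :=
  M.E = univ ∧ ∀ B : Set (Fin n),
    M.IsBase B ↔ LinearIndepOn ℝ A.col B ∧ Submodule.span ℝ (A.col '' B) = ⊤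

/-- A full rank `d × n` real matrix all of whose maximal minors are nonnegative. -/
def IsTotallyNonneg {n d : ℕ} (A : Matrix (Fin d) (Fin n) ℝ) : Prop :=
  A.rank = d ∧ ∀ f : Fin d ↪o Fin n, 0 ≤ (A.submatrix id f).det

/-- A positroid on `[n]` (with its usual order). -/
def IsPositroid {n : ℕ} (M : Matroid (Fin n)) : Prop :=
  ∃ (d : ℕ) (A : Matrix (Fin d) (Fin n) ℝ), IsTotallyNonneg A ∧ IsMatroidOf M A

/-! ### Connected components of a matroid -/

/-- A matroid is connected if it is not the direct sum of two nonempty matroids. -/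
def IsConnected {α : Type*} (M : Matroid α) : Prop :=
  ∀ (M₁ M₂ : Matroid α) (h : Disjoint M₁.E M₂.E), M = M₁.disjointSum M₂ h →
    M₁.E = ∅ ∨ M₂.E = ∅

/-- The collection `Π_M` of the ground sets of the connected components of `M`, i.e. of the
nonempty connected direct summands of `M`. -/
def componentBlocks {α : Type*} (M : Matroid α) : Set (Set α) :=
  {S | S.Nonempty ∧ ∃ (N N' : Matroid α) (h : Disjoint N.E N'.E),
    N.E = S ∧ IsConnected N ∧ M = N.disjointSum N' h}

/-! ### Non-crossing partitions -/

/-- The four points `a, b, c, d` are distinct and in this cyclic order around the circle. -/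
def InCyclicOrder {n : ℕ} (a b c d : Fin n) : Prop :=
  (a < b ∧ b < c ∧ c < d) ∨ (b < c ∧ c < d ∧ d < a) ∨
    (c < d ∧ d < a ∧ a < b) ∨ (d < a ∧ a < b ∧ b < c)

/-- A collection `P` of subsets of `[n]` is a non-crossing partition of `[n]`. -/
def IsNonCrossingPartition {n : ℕ} (P : Set (Set (Fin n))) : Prop :=
  Setoid.IsPartition P ∧ ∀ S ∈ P, ∀ T ∈ P, S ≠ T →
    ¬ ∃ a b c d : Fin n, InCyclicOrder a b c d ∧ a ∈ S ∧ c ∈ S ∧ b ∈ T ∧ d ∈ T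

/-- `P` is finer than (or equal to) `Q`. -/
def Refines {α : Type*} (P Q : Set (Set α)) : Prop :=
  ∀ S ∈ P, ∃ T ∈ Q, S ⊆ T

/-! ### Grassmann necklaces and decorated permutations -/

/-- A decorated permutation: a permutation with each fixed point coloured either counterclockwise
(the elements of `ccw`) or clockwise (the fixed points not in `ccw`). -/
structure DecoratedPerm (n : ℕ) where
  perm : Equiv.Perm (Fin n)
  ccw : Set (Fin n)
  perm_of_mem_ccw : ∀ i ∈ ccw, perm i = i

/-- The order `<_k` on `[n]`, namely `k <_k k+1 <_k ⋯ <_k n <_k 1 <_k ⋯ <_k k-1`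
(here `a - k` is subtraction modulo `n`, the position of `a` counted from `k`). -/
def CycLT {n : ℕ} (k a b : Fin n) : Prop := a - k < b - k

/-- For sets `S`, `T` of the same size: the list of the elements of `S` in `<_k`-increasing order
is lexicographically smaller than that of `T`. -/
def LexLT {n : ℕ} (k : Fin n) (S T : Set (Fin n)) : Prop :=
  ∃ a ∈ S, a ∉ T ∧ ∀ b, CycLT k b a → (b ∈ S ↔ b ∈ T)

/-- `B` is the lexicographically minimal basis of `M` with respect to `<_k`. -/
def IsLexMinBase {n : ℕ} (M : Matroid (Fin n)) (k : Fin n) (B : Set (Fin n)) : Prop :=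
  M.IsBase B ∧ ∀ B', M.IsBase B' → B' ≠ B → LexLT k B B'

/-- The decorated permutation `π` is the one read off from the necklace `I = (I_1, …, I_n)`. -/
def IsReadFrom {n : ℕ} (π : DecoratedPerm n) (I : Fin n → Set (Fin n)) : Prop :=
  (∀ i j, i ∈ I i → j ≠ i → I (finRotate n i) = insert j (I i \ {i}) → π.perm j = i) ∧
  (∀ i, i ∉ I i → I (finRotate n i) = I i → π.perm i = i ∧ i ∉ π.ccw) ∧
  (∀ i, i ∈ I i → I (finRotate n i) = I i → π.perm i = i ∧ i ∈ π.ccw)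

section Existence

variable {n : ℕ}

theorem cycLT_trans {k a b c : Fin n} (h : CycLT k a b) (h' : CycLT k b c) : CycLT k a c :=
  lt_trans (α := Fin n) h h'

theorem cycLT_irrefl {k a : Fin n} : ¬ CycLT k a a := lt_irrefl (α := Fin n) _

theorem cycLT_trichotomy (k a b : Fin n) : CycLT k a b ∨ a = b ∨ CycLT k b a := by
  rcases n with _ | m
  · exact a.elim0
  · rcases lt_trichotomy (a - k) (b - k) with h | h | h
    · exact Or.inl h
    · exact Or.inr (Or.inl (sub_left_injective h))
    · exact Or.inr (Or.inr h)

theorem cycLT_of_rotate {i e j : Fin n} (he : e ≠ i) (h : CycLT (finRotate n i) j e) :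
    CycLT i j e := by
  rcases n with _ | m
  · exact e.elim0
  · simp only [CycLT, finRotate_apply] at h ⊢
    have h1 : j - (i + 1) = (j - i) - 1 := by abel
    have h2 : e - (i + 1) = (e - i) - 1 := by abel
    rw [h1, h2] at h
    have hy : e - i ≠ 0 := sub_ne_zero.mpr he
    by_cases hx : j - i = 0
    · rw [hx]; exact Fin.pos_of_ne_zero hy
    · rw [Fin.lt_def, Fin.val_sub_one_of_ne_zero hy, Fin.val_sub_one_of_ne_zero hx] at h
      rw [Fin.lt_def]; omega

theorem lexLT_irrefl {k : Fin n} {S : Set (Fin n)} : ¬ LexLT k S S := by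
  rintro ⟨a, h, h', -⟩; exact h' h

theorem lexLT_trans {k : Fin n} {S T U : Set (Fin n)} (h : LexLT k S T) (h' : LexLT k T U) :
    LexLT k S U := by
  obtain ⟨a, haS, haT, ha⟩ := h
  obtain ⟨b, hbT, hbU, hb⟩ := h'
  rcases cycLT_trichotomy k a b with hab | rfl | hab
  · exact ⟨a, haS, fun hU => haT ((hb a hab).2 hU),
      fun c hc => (ha c hc).trans (hb c (cycLT_trans hc hab))⟩
  · exact absurd hbT haT
  · exact ⟨b, (ha b hab).2 hbT, hbU,
      fun c hc => (ha c (cycLT_trans hc hab)).trans (hb c hc)⟩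

theorem lexLT_total {k : Fin n} {S T : Set (Fin n)} (h : S ≠ T) :
    LexLT k S T ∨ LexLT k T S := by
  have hne : {a | ¬ (a ∈ S ↔ a ∈ T)}.Nonempty := by
    by_contra hcon
    refine h (Set.ext fun a => ?_)
    by_contra ha
    exact hcon ⟨a, ha⟩
  have hwf : WellFounded (CycLT k) :=
    InvImage.wf (fun a : Fin n => a - k) (wellFounded_lt (α := Fin n))
  have hm := hwf.min_mem _ hne
  have hmin : ∀ b, CycLT k b (hwf.min _ hne) → (b ∈ S ↔ b ∈ T) := by
    intro b hb
    by_contra hcon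
    exact hwf.not_lt_min _ hcon hb
  generalize hwf.min _ hne = m at hm hmin
  by_cases hS : m ∈ S
  · exact Or.inl ⟨m, hS, fun hT => hm ⟨fun _ => hT, fun _ => hS⟩, hmin⟩
  · refine Or.inr ⟨m, ?_, hS, fun b hb => (hmin b hb).symm⟩
    by_contra hT
    exact hm ⟨fun h => absurd h hS, fun h => absurd h hT⟩

/-- Every matroid on `[n]` has exactly one lexicographically minimal basis for each `<_k`. -/
theorem existsUnique_isLexMinBase (M : Matroid (Fin n)) (k : Fin n) :
    ∃! B, IsLexMinBase M k B := by
  have : IsTrans (Set (Fin n)) (LexLT k) := ⟨fun _ _ _ => lexLT_trans⟩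
  have : Std.Irrefl (LexLT (n := n) k) := ⟨fun _ => lexLT_irrefl⟩
  have hwf : WellFounded (LexLT (n := n) k) := Finite.wellFounded_of_trans_of_irrefl _
  have hne : {B | M.IsBase B}.Nonempty := M.exists_isBase
  refine ⟨hwf.min _ hne, ⟨hwf.min_mem _ hne, fun B' hB' hne' => ?_⟩, ?_⟩
  · exact (lexLT_total hne'.symm).resolve_right (hwf.not_lt_min _ hB')
  · intro B' hB'
    by_contra hcon
    exact hwf.not_lt_min _ hB'.1 (hB'.2 _ (hwf.min_mem _ hne) (Ne.symm hcon))

end Existence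

/-- The Grassmann necklace `I(M) = (I_1, …, I_n)` of a matroid on `[n]`: `I_k` is the
lexicographically minimal basis of `M` with respect to `<_k`. -/
noncomputable def necklace {n : ℕ} (M : Matroid (Fin n)) (k : Fin n) : Set (Fin n) :=
  (existsUnique_isLexMinBase M k).choose

section Existence

variable {n : ℕ}

theorem necklace_spec (M : Matroid (Fin n)) (k : Fin n) : IsLexMinBase M k (necklace M k) :=
  (existsUnique_isLexMinBase M k).choose_spec.1

theorem mem_closure_of_notMem_necklace {M : Matroid (Fin n)} {k e : Fin n} (heE : e ∈ M.E)
    (he : e ∉ necklace M k) : e ∈ M.closure (necklace M k ∩ {j | CycLT k j e}) := by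
  obtain ⟨hB, hmin⟩ := necklace_spec M k
  generalize necklace M k = B at he hB hmin ⊢
  have hcl : e ∈ M.closure B := by rw [hB.closure_eq]; exact heE
  have hC := hB.indep.fundCircuit_isCircuit hcl he
  have hsub : M.fundCircuit e B \ {e} ⊆ B := by
    intro x hx
    exact ((M.fundCircuit_subset_insert e B) hx.1).resolve_left hx.2
  by_cases hall : ∀ f ∈ M.fundCircuit e B \ {e}, CycLT k f e
  · exact M.closure_subset_closure (Set.subset_inter hsub hall)
      (hC.mem_closure_sdiff_singleton_of_mem (M.mem_fundCircuit e B))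
  · push Not at hall
    obtain ⟨f, hf, hfe⟩ := hall
    have hfB := hsub hf
    have hlt : CycLT k e f := by
      rcases cycLT_trichotomy k e f with h | h | h
      · exact h
      · exact absurd h.symm hf.2
      · exact absurd h hfe
    have hind : M.Indep (insert e B \ {f}) :=
      (hB.indep.mem_fundCircuit_iff hcl he).1 hf.1
    have hB' : M.IsBase (insert e (B \ {f})) := by
      refine hB.exchange_isBase_of_indep he ?_
      rwa [Set.insert_sdiff_singleton_comm (Ne.symm hf.2)]
    have hne : insert e (B \ {f}) ≠ B := fun h => he (h ▸ Set.mem_insert _ _)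
    obtain ⟨a, haB, haB', ha⟩ := hmin _ hB' hne
    have haf : a = f := by
      by_contra hcon
      exact haB' (Or.inr ⟨haB, hcon⟩)
    subst haf
    exact absurd ((ha e hlt).2 (Set.mem_insert _ _)) he

theorem mem_necklace_iff {M : Matroid (Fin n)} {k e : Fin n} (heE : e ∈ M.E) :
    e ∈ necklace M k ↔ e ∉ M.closure {j | CycLT k j e} := by
  have hB := (necklace_spec M k).1
  constructor
  · intro he hcl
    have hX : M.closure {j | CycLT k j e} ⊆ M.closure (necklace M k \ {e}) := by
      rw [← M.closure_inter_ground]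
      refine M.closure_subset_closure_of_subset_closure ?_
      rintro x ⟨hx, hxE⟩
      have hxe : x ≠ e := fun h => cycLT_irrefl (k := k) (a := e) (by rw [h] at hx; exact hx)
      by_cases hxB : x ∈ necklace M k
      · exact M.mem_closure_of_mem' ⟨hxB, hxe⟩ hxE
      · refine M.closure_subset_closure ?_ (mem_closure_of_notMem_necklace hxE hxB)
        rintro y ⟨hyB, hy⟩
        refine ⟨hyB, fun h => ?_⟩
        have h' : y = e := h
        rw [h'] at hy
        exact cycLT_irrefl (cycLT_trans hy hx)
    exact hB.indep.notMem_closure_sdiff_of_mem he (hX hcl)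
  · intro h
    by_contra he
    exact h (M.closure_subset_closure Set.inter_subset_right
      (mem_closure_of_notMem_necklace heE he))

theorem necklace_sdiff_subset (M : Matroid (Fin n)) (i : Fin n) :
    necklace M i \ {i} ⊆ necklace M (finRotate n i) := by
  rintro e ⟨he, hei⟩
  have heE := (necklace_spec M i).1.subset_ground he
  rw [mem_necklace_iff heE] at he ⊢
  exact fun h => he (M.closure_subset_closure (fun j hj => cycLT_of_rotate hei hj) h)

/-- The necklace condition for the sequence of lexicographically minimal bases. -/
theorem necklace_step (M : Matroid (Fin n)) (i : Fin n) :
    ∃ j, (i ∈ necklace M i → j ∉ necklace M i \ {i} ∧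
        necklace M (finRotate n i) = insert j (necklace M i \ {i})) ∧
      (i ∉ necklace M i → j = i ∧ necklace M (finRotate n i) = necklace M i) := by
  have hsub := necklace_sdiff_subset M i
  have hcard := (necklace_spec M i).1.ncard_eq_ncard_of_isBase
    (necklace_spec M (finRotate n i)).1
  by_cases hi : i ∈ necklace M i
  · have h1 := Set.ncard_sdiff_singleton_add_one hi (Set.toFinite _)
    obtain ⟨j, hj, hjn⟩ := Set.exists_mem_notMem_of_ncard_lt_ncard
      (s := necklace M i \ {i}) (t := necklace M (finRotate n i)) (by omega) (Set.toFinite _)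
    refine ⟨j, fun _ => ⟨hjn, ?_⟩, fun h => absurd hi h⟩
    symm
    refine Set.eq_of_subset_of_ncard_le (Set.insert_subset hj hsub) ?_ (Set.toFinite _)
    rw [Set.ncard_insert_of_notMem hjn (Set.toFinite _)]
    omega
  · refine ⟨i, fun h => absurd h hi, fun _ => ⟨rfl, ?_⟩⟩
    rw [Set.sdiff_singleton_eq_self hi] at hsub
    exact (Set.eq_of_subset_of_ncard_le hsub hcard.ge (Set.toFinite _)).symm

theorem forall_of_finRotate {p : Fin n → Prop} {a : Fin n} (ha : p a)
    (h : ∀ i, p i → p (finRotate n i)) (b : Fin n) : p b := by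
  rcases n with _ | m
  · exact a.elim0
  · have key : ∀ c : Fin (m + 1), p (a + c) := by
      intro c
      induction c using Fin.induction with
      | zero => simpa using ha
      | succ t ih =>
        have := h _ ih
        rw [finRotate_apply] at this
        rwa [← Fin.coeSucc_eq_succ, ← add_assoc]
    have := key (b - a)
    rwa [add_sub_cancel] at this

/-- Every matroid on `[n]` has exactly one decorated permutation. -/
theorem existsUnique_isReadFrom (M : Matroid (Fin n)) :
    ∃! π : DecoratedPerm n, IsReadFrom π (necklace M) := by
  choose σ hσ1 hσ2 using necklace_step M
  have hfix : ∀ i, i ∈ necklace M i → i ∈ necklace M (finRotate n i) → σ i = i := by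
    intro i hi h
    rw [(hσ1 i hi).2] at h
    rcases h with h | h
    · exact h.symm
    · exact absurd rfl h.2
  have hsurj : Function.Surjective σ := by
    intro j
    by_cases hj : j ∈ necklace M j
    · by_cases hj' : j ∈ necklace M (finRotate n j)
      · exact ⟨j, hfix j hj hj'⟩
      · by_contra hcon
        push Not at hcon
        refine forall_of_finRotate (p := fun k => j ∉ necklace M k) hj' (fun i hi hi' => ?_) j hj
        by_cases hii : i ∈ necklace M i
        · rw [(hσ1 i hii).2] at hi'
          rcases hi' with h | h
          · exact hcon i h.symm
          · exact hi h.1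
        · rw [(hσ2 i hii).2] at hi'
          exact hi hi'
    · exact ⟨j, (hσ2 j hj).1⟩
  have hbij : Function.Bijective σ := Finite.surjective_iff_bijective.1 hsurj
  let τ : Equiv.Perm (Fin n) := Equiv.ofBijective σ hbij
  have hτ : ∀ i j, σ i = j → τ.symm j = i := by
    intro i j h
    rw [Equiv.symm_apply_eq]
    exact h.symm
  have hstep : ∀ i j, i ∈ necklace M i →
      necklace M (finRotate n i) = insert j (necklace M i \ {i}) → σ i = j := by
    intro i j hi h
    have h1 : σ i ∈ necklace M (finRotate n i) := by
      rw [(hσ1 i hi).2]; exact Set.mem_insert _ _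
    rw [h] at h1
    exact h1.resolve_right (hσ1 i hi).1
  refine ⟨⟨τ.symm, {i | i ∈ necklace M i ∧ necklace M (finRotate n i) = necklace M i}, ?_⟩,
    ⟨?_, ?_, ?_⟩, ?_⟩
  · rintro i ⟨hi, h⟩
    exact hτ i i (hfix i hi (h ▸ hi))
  · intro i j hi _ h
    exact hτ i j (hstep i j hi h)
  · intro i hi _
    exact ⟨hτ i i (hσ2 i hi).1, fun h => hi h.1⟩
  · intro i hi h
    exact ⟨hτ i i (hfix i hi (h.symm ▸ hi)), hi, h⟩
  · rintro ⟨ρ, c, hc⟩ ⟨h1, h2, h3⟩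
    have hρ : ∀ i, ρ (σ i) = i := by
      intro i
      by_cases hi : i ∈ necklace M i
      · by_cases hs : σ i = i
        · have : necklace M (finRotate n i) = necklace M i := by
            rw [(hσ1 i hi).2, hs, Set.insert_sdiff_singleton, Set.insert_eq_of_mem hi]
          rw [hs]; exact (h3 i hi this).1
        · exact h1 i (σ i) hi hs (hσ1 i hi).2
      · rw [(hσ2 i hi).1]; exact (h2 i hi (hσ2 i hi).2).1
    have hρτ : ρ = τ.symm := by
      ext1 j
      obtain ⟨i, rfl⟩ := hsurj j
      rw [hρ i, hτ i _ rfl]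
    subst hρτ
    congr 1
    ext i
    constructor
    · intro hic
      have hi : i ∈ necklace M i := by
        by_contra hi
        exact (h2 i hi (hσ2 i hi).2).2 hic
      have hs : σ i = i := ((Equiv.symm_apply_eq τ).1 (hc i hic)).symm
      refine ⟨hi, ?_⟩
      rw [(hσ1 i hi).2, hs, Set.insert_sdiff_singleton, Set.insert_eq_of_mem hi]
    · rintro ⟨hi, h⟩
      exact (h3 i hi h).2

end Existence

/-- The decorated permutation of a matroid on `[n]`, read off from its Grassmann necklace. -/
noncomputable def decoratedPerm {n : ℕ} (M : Matroid (Fin n)) : DecoratedPerm n :=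
  (existsUnique_isReadFrom M).choose

theorem decoratedPerm_spec {n : ℕ} (M : Matroid (Fin n)) :
    IsReadFrom (decoratedPerm M) (necklace M) :=
  (existsUnique_isReadFrom M).choose_spec.1

/-! ### Chord diagrams -/

/-- The vertices `1, …, n`, equally spaced around the unit circle in clockwise order. -/
noncomputable def circlePoint {n : ℕ} (i : Fin n) : ℂ :=
  Complex.exp (-(2 * Real.pi * (i : ℝ) / n : ℝ) * Complex.I)

/-- The chord diagram of `π`, as a subset of the plane: the union of the (straight, possibly
degenerate) chords joining `i` to `π(i)`. -/
def chordDiagram {n : ℕ} (π : DecoratedPerm n) : Set ℂ :=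
  ⋃ i : Fin n, segment ℝ (circlePoint i) (circlePoint (π.perm i))

/-- The sets of vertices of the connected components of the chord diagram. -/
def chordBlocks {n : ℕ} (π : DecoratedPerm n) : Set (Set (Fin n)) :=
  {S | ∃ x ∈ chordDiagram π,
    S = {i | circlePoint i ∈ connectedComponentIn (chordDiagram π) x}}

end Positroid

/-!
The connected components of a matroid are the atoms of its Boolean algebra of separators, a separator
being a set `K` such that no circuit meets both `K` and its complement
(`componentBlocks_eq_classes`). Four facts give the theorem.

* `compSetoid_perm`: `j` and `π(j)` lie in the same component, as both lie on the fundamental circuit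
  of `j` with respect to the basis `I_{π(j)}`. This holds for every matroid.
* `componentBlocks_refines`: the components refine every non-crossing partition with `π`-invariant
  blocks. Two elements in different blocks of such a partition are separated by a `π`-invariant
  interval (`IsNonCrossingPartition.exists_Icc`), and the Grassmann necklace shows that a
  `π`-invariant interval is a separator (`isSeparator_Icc`). This too holds for every matroid.
* `isNonCrossingPartition_componentBlocks`: the components of a positroid do not cross. If two of them
  did, then so would a circuit through `a`, `c` and a circuit through `b`, `d`; completing them to a
  basis and exchanging gives a three-term Plücker relation
  `p_{ac} p_{bd} = p_{ab} p_{cd} + p_{ad} p_{bc}` with nonnegative terms whose left side vanishes and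
  whose right side does not (`chordSide_mul_nonneg_of_exchange`). The signs are handled by comparing
  each minor, with its columns in any order, with the Vandermonde determinant of the column labels
  (`IsTotallyNonneg.det_mul_vandermonde_nonneg`).
* The components of the chord diagram form a non-crossing partition of the vertices with
  `π`-invariant blocks (`isNonCrossingPartition_chordBlocks`), and they refine every such partition
  (`chordBlocks_refines`). Being the finest such partition, they agree with the components of the
  positroid. Both facts rest on affine functions whose signs at the vertices are given by polynomials
  in the labels (`exists_lineSide_circlePoint`) and on the intermediate value theorem.
-/

namespace Positroid

open scoped Matroid

/-! ### Separators and connected components of a matroid -/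

section Separator

variable {α : Type*} {M : Matroid α} {K : Set α}

/-- A separator of `M`: a set `K` such that no circuit of `M` meets both `K` and its complement.
No inclusion of `K` in the ground set is required. -/
def IsSeparator (M : Matroid α) (K : Set α) : Prop :=
  ∀ C, M.IsCircuit C → ∀ u ∈ C, ∀ v ∈ C, u ∈ K → v ∈ K

theorem isSeparator_disjointSum (M₁ M₂ : Matroid α) (h : Disjoint M₁.E M₂.E) :
    IsSeparator (M₁.disjointSum M₂ h) M₁.E := by
  intro C hC u hu v hv huE
  by_contra hvE
  have h1 := hC.ssubset_indep (X := C ∩ M₁.E)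
    ⟨inter_subset_left, fun hs => hvE (hs hv).2⟩
  have h2 := hC.ssubset_indep (X := C ∩ M₂.E)
    ⟨inter_subset_left, fun hs => h.notMem_of_mem_left huE (hs hu).2⟩
  rw [Matroid.disjointSum_indep_iff, inter_assoc, inter_self] at h1
  rw [Matroid.disjointSum_indep_iff, inter_assoc C M₂.E M₂.E, inter_self] at h2
  refine hC.not_indep ?_
  rw [Matroid.disjointSum_indep_iff]
  exact ⟨h1.1, h2.2.1, by simpa using hC.subset_ground⟩

theorem disjoint_restrict_sdiff (M : Matroid α) (K : Set α) :
    Disjoint (M ↾ K).E (M ↾ (M.E \ K)).E :=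
  disjoint_sdiff_right (s := K) (t := M.E)

theorem IsSeparator.eq_disjointSum (hK : IsSeparator M K) (hKE : K ⊆ M.E) :
    M = (M ↾ K).disjointSum (M ↾ (M.E \ K)) (disjoint_restrict_sdiff M K) := by
  refine Matroid.ext_indep ?_ fun I hI => ?_
  · rw [Matroid.disjointSum_ground_eq]
    exact (union_sdiff_cancel hKE).symm
  · rw [Matroid.disjointSum_indep_iff, Matroid.restrict_ground_eq, Matroid.restrict_ground_eq,
      Matroid.restrict_indep_iff, Matroid.restrict_indep_iff, and_iff_left inter_subset_right,
      and_iff_left inter_subset_right]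
    refine ⟨fun h => ⟨h.subset inter_subset_left, h.subset inter_subset_left, ?_⟩, ?_⟩
    · exact hI.trans (union_sdiff_cancel hKE).ge
    · rintro ⟨h1, h2, -⟩
      by_contra hcon
      obtain ⟨C, hCI, hC⟩ := ((Matroid.not_indep_iff hI).1 hcon).exists_isCircuit_subset
      obtain ⟨u, hu⟩ := hC.nonempty
      by_cases huK : u ∈ K
      · exact hC.not_indep (h1.subset fun v hv => ⟨hCI hv, hK C hC u hu v hv huK⟩)
      · exact hC.not_indep (h2.subset fun v hv =>
          ⟨hCI hv, hI (hCI hv), fun hvK => huK (hK C hC v hv u hu hvK)⟩)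

/-- The relation of lying in the same connected component of `M`, expressed by the fact that the
connected components are the atoms of the Boolean algebra of separators. -/
def compSetoid (M : Matroid α) : Setoid α where
  r x y := ∀ K, IsSeparator M K → (x ∈ K ↔ y ∈ K)
  iseqv := ⟨fun _ _ _ => Iff.rfl, fun h K hK => (h K hK).symm,
    fun h h' K hK => (h K hK).trans (h' K hK)⟩

theorem compSetoid_of_isCircuit {C : Set α} {x y : α} (hC : M.IsCircuit C) (hx : x ∈ C)
    (hy : y ∈ C) : compSetoid M x y :=
  fun _ hK => ⟨hK C hC x hx y hy, hK C hC y hy x hx⟩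

theorem isSeparator_class (M : Matroid α) (x : α) : IsSeparator M {y | compSetoid M y x} :=
  fun _ hC _ hu _ hv h => (compSetoid M).trans (compSetoid_of_isCircuit hC hv hu) h

theorem componentBlocks_eq_classes (hE : M.E = univ) :
    componentBlocks M = (compSetoid M).classes := by
  ext S
  constructor
  · rintro ⟨⟨x, hx⟩, N, N', h, rfl, hN, hM⟩
    refine ⟨x, Set.ext fun y => ⟨fun hy => ?_, fun hy => ?_⟩⟩
    · by_contra hcon
      -- otherwise the class of `x` splits `N` into two nonempty summands
      have hres : N = M ↾ N.E := by
        refine Matroid.ext_indep rfl fun I hI => ?_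
        have h0 : I ∩ N'.E = ∅ := disjoint_iff_inter_eq_empty.1 (h.mono_left hI)
        rw [Matroid.restrict_indep_iff, hM, Matroid.disjointSum_indep_iff,
          inter_eq_left.2 hI, h0]
        simp [hI, subset_union_of_subset_left hI]
      have hsep : IsSeparator N (N.E ∩ {y | compSetoid M y x}) := by
        intro C hC u hu v hv huK
        refine ⟨hC.subset_ground hv, isSeparator_class M x C ?_ u hu v hv huK.2⟩
        rw [hres] at hC
        exact ((Matroid.restrict_isCircuit_iff (by rw [hE]; exact subset_univ _)).1 hC).1
      rcases hN _ _ _ (hsep.eq_disjointSum inter_subset_left) with h0 | h0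
      · have : x ∈ N.E ∩ {y | compSetoid M y x} := ⟨hx, (compSetoid M).refl x⟩
        rw [Matroid.restrict_ground_eq] at h0
        exact absurd this (by rw [h0]; exact notMem_empty x)
      · have : y ∈ N.E \ (N.E ∩ {y | compSetoid M y x}) := ⟨hy, fun h => hcon h.2⟩
        rw [Matroid.restrict_ground_eq] at h0
        exact absurd this (by rw [h0]; exact notMem_empty y)
    · exact (hy N.E (hM ▸ isSeparator_disjointSum N N' h)).2 hx
  · rintro ⟨x, rfl⟩
    have hKE : {y | compSetoid M y x} ⊆ M.E := by rw [hE]; exact subset_univ _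
    refine ⟨⟨x, (compSetoid M).refl x⟩, M ↾ {y | compSetoid M y x},
      M ↾ (M.E \ {y | compSetoid M y x}), disjoint_restrict_sdiff _ _, rfl, ?_,
      (isSeparator_class M x).eq_disjointSum hKE⟩
    intro M₁ M₂ h hM
    by_contra! hne
    obtain ⟨⟨u, hu⟩, ⟨v, hv⟩⟩ := hne
    have hg : {y | compSetoid M y x} = M₁.E ∪ M₂.E := by
      have := congrArg Matroid.E hM
      simpa using this
    have hux : compSetoid M u x := hg.ge (Or.inl hu)
    have hvx : compSetoid M v x := hg.ge (Or.inr hv)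
    have hsep : IsSeparator M M₁.E := by
      intro C hC a ha b hb haE
      have hCK : C ⊆ {y | compSetoid M y x} := fun c hc =>
        isSeparator_class M x C hC a ha c hc (hg.ge (Or.inl haE))
      have := isSeparator_disjointSum M₁ M₂ h
      rw [← hM] at this
      exact this C (hC.isCircuit_restrict_of_subset hCK) a ha b hb haE
    exact h.notMem_of_mem_left
      (((compSetoid M).trans hux ((compSetoid M).symm hvx) _ hsep).1 hu) hv

end Separator

/-! ### Chords of the decorated permutation and invariant intervals -/

section Necklace

variable {n : ℕ} {M : Matroid (Fin n)}

/-- If `π(j) = i ≠ j` then `I_{i+1}` arises from `I_i` by exchanging `i` for `j`, so that the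
fundamental circuit of `j` in `I_i` contains `i`. -/
theorem compSetoid_perm (hE : M.E = univ) (j : Fin n) :
    compSetoid M j ((decoratedPerm M).perm j) := by
  obtain ⟨h1, h2, h3⟩ := decoratedPerm_spec M
  generalize hi : (decoratedPerm M).perm j = i
  obtain ⟨j', hj1, hj2⟩ := necklace_step M i
  have hfix : (decoratedPerm M).perm i = i → compSetoid M j i := fun h => by
    rw [(decoratedPerm M).perm.injective (hi.trans h.symm)]
  by_cases hmem : i ∈ necklace M i
  · obtain ⟨hj', hs⟩ := hj1 hmem
    by_cases hji : j' = i
    · rw [hji, insert_sdiff_singleton, insert_eq_of_mem hmem] at hs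
      exact hfix (h3 i hmem hs).1
    · obtain rfl : j' = j := (decoratedPerm M).perm.injective
        ((h1 i j' hmem hji hs).trans hi.symm)
      have hB := (necklace_spec M i).1
      have hB' := (necklace_spec M (finRotate n i)).1
      have hjB : j' ∉ necklace M i := fun h => hj' ⟨h, hji⟩
      have hcl : j' ∈ M.closure (necklace M i) := by
        rw [hB.closure_eq, hE]; exact mem_univ _
      refine compSetoid_of_isCircuit (hB.indep.fundCircuit_isCircuit hcl hjB)
        (M.mem_fundCircuit _ _) ((hB.indep.mem_fundCircuit_iff hcl hjB).2 ?_)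
      rw [← insert_sdiff_singleton_comm hji, ← hs]
      exact hB'.indep
  · exact hfix (h2 i hmem (hj2 hmem).2).1

/-- Passing from `I_i` to `I_{i+1}` with `i` in a `π`-invariant set `J` changes nothing outside
`J`. -/
theorem necklace_succ_inter_compl {J : Set (Fin n)}
    (hJ : ∀ j, (decoratedPerm M).perm j ∈ J → j ∈ J) {i : Fin n} (hi : i ∈ J) :
    necklace M (finRotate n i) ∩ Jᶜ = necklace M i ∩ Jᶜ := by
  obtain ⟨h1, -, -⟩ := decoratedPerm_spec M
  obtain ⟨j, hj1, hj2⟩ := necklace_step M i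
  by_cases hmem : i ∈ necklace M i
  · have hs := (hj1 hmem).2
    have hjJ : j ∈ J := by
      by_cases hji : j = i
      · rwa [hji]
      · exact hJ j (by rwa [h1 i j hmem hji hs])
    rw [hs]
    ext x
    constructor
    · rintro ⟨rfl | hx, hxJ⟩
      · exact absurd hjJ hxJ
      · exact ⟨hx.1, hxJ⟩
    · rintro ⟨hx, hxJ⟩
      exact ⟨Or.inr ⟨hx, fun h => hxJ (by rw [h]; exact hi)⟩, hxJ⟩
  · rw [(hj2 hmem).2]

theorem cycLT_iff_of_le {k j e : Fin n} (h : k ≤ e) : CycLT k j e ↔ k ≤ j ∧ j < e := by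
  rw [CycLT, Fin.lt_def, Fin.sub_def, Fin.sub_def]
  simp only [Fin.le_def, Fin.lt_def] at h ⊢
  have h1 := k.2; have h2 := j.2; have h3 := e.2
  have he : (n - k + e : ℕ) % n = e - k := by
    rw [show (n - k + e : ℕ) = (e - k) + n by omega, Nat.add_mod_right, Nat.mod_eq_of_lt (by omega)]
  rw [he]
  rcases lt_or_ge (j : ℕ) (k : ℕ) with hj | hj
  · rw [Nat.mod_eq_of_lt (by omega)]; omega
  · rw [show (n - k + j : ℕ) = (j - k) + n by omega, Nat.add_mod_right, Nat.mod_eq_of_lt (by omega)]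
    omega

theorem cycLT_of_lt {k j e : Fin n} (h : e < k) (hj : CycLT k j e) : k ≤ j ∨ j < e := by
  rw [CycLT, Fin.lt_def, Fin.sub_def, Fin.sub_def] at hj
  simp only [Fin.le_def, Fin.lt_def] at h hj ⊢
  have h1 := k.2; have h2 := j.2; have h3 := e.2
  rw [Nat.mod_eq_of_lt (show (n - k + e : ℕ) < n by omega)] at hj
  rcases lt_or_ge (j : ℕ) (k : ℕ) with h' | h'
  · rw [Nat.mod_eq_of_lt (by omega)] at hj; omega
  · exact Or.inl h'

theorem notMem_Icc_of_cycLT {a k j e : Fin n} (hak : a ≤ k) (he : e ∉ Icc a k)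
    (hj : CycLT (finRotate n k) j e) : j ∉ Icc a k := by
  rcases n with _ | m
  · exact a.elim0
  rw [mem_Icc, not_and_or, not_le, not_le] at he
  rw [mem_Icc, not_and_or, not_le, not_le]
  by_cases hk : k = Fin.last m
  · rw [hk, finRotate_last, cycLT_iff_of_le (Fin.zero_le e)] at hj
    rcases he with he | he
    · exact Or.inl (hj.2.trans he)
    · exact absurd (Fin.le_last e) (by rw [← hk]; exact not_le.2 he)
  · have hlt : k < Fin.last m := lt_of_le_of_ne (Fin.le_last k) hk
    have hv : (finRotate (m + 1) k : ℕ) = k + 1 := coe_finRotate_of_ne_last hk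
    simp only [Fin.lt_def, Fin.le_def] at *
    rcases le_or_gt (finRotate (m + 1) k) e with h | h
    · have := (cycLT_iff_of_le h).1 hj
      simp only [Fin.lt_def, Fin.le_def] at this
      omega
    · have := cycLT_of_lt h hj
      simp only [Fin.lt_def, Fin.le_def] at this h
      omega

/-- An interval invariant under the decorated permutation is a separator. The part of `I_a` in the
interval `[a, k]` spans it, by the greedy property of `I_a`; the part of `I_{k+1}` outside the
interval spans the complement for the same reason, and it coincides with the part of `I_a` outside
the interval, as only elements of the interval are exchanged between `I_a` and `I_{k+1}`. Hence the
basis `I_a` splits into bases of the interval and of its complement. -/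
theorem isSeparator_Icc (hE : M.E = univ) {a k : Fin n} (hak : a ≤ k)
    (hJ : ∀ j, (decoratedPerm M).perm j ∈ Icc a k → j ∈ Icc a k) : IsSeparator M (Icc a k) := by
  have hchain : ∀ m : ℕ, ∀ hm : m < n, (⟨m, hm⟩ : Fin n) ∈ Icc a k →
      necklace M (finRotate n ⟨m, hm⟩) ∩ (Icc a k)ᶜ = necklace M a ∩ (Icc a k)ᶜ := by
    intro m
    induction m with
    | zero =>
      intro hm h
      rw [necklace_succ_inter_compl hJ h]
      congr 2
      exact (le_antisymm h.1 (Fin.le_def.2 (Nat.zero_le _))).symm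
    | succ m ih =>
      intro hm h
      rw [necklace_succ_inter_compl hJ h]
      by_cases ha : a = ⟨m + 1, hm⟩
      · rw [← ha]
      · have hm' : (⟨m, by omega⟩ : Fin n) ∈ Icc a k := by
          have h1 := lt_of_le_of_ne h.1 ha
          have h2 := h.2
          simp only [Fin.lt_def, Fin.le_def, mem_Icc] at *
          omega
        have hr : finRotate n ⟨m, by omega⟩ = ⟨m + 1, hm⟩ := by
          rcases n with _ | n'
          · omega
          · exact finRotate_of_lt (by omega)
        rw [← ih (by omega) hm', hr]
  have hcompl : necklace M (finRotate n k) ∩ (Icc a k)ᶜ = necklace M a ∩ (Icc a k)ᶜ :=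
    hchain k k.2 ⟨hak, le_rfl⟩
  have hB := (necklace_spec M a).1
  set J := Icc a k with hJdef
  set B := necklace M a with hBdef
  have hX : J ⊆ M.closure (B ∩ J) := by
    intro e he
    by_cases heB : e ∈ B
    · exact M.mem_closure_of_mem' ⟨heB, he⟩ (hE ▸ mem_univ e)
    · refine M.closure_subset_closure ?_
        (mem_closure_of_notMem_necklace (hE ▸ mem_univ e) heB)
      rintro j ⟨hjB, hj⟩
      have := (cycLT_iff_of_le he.1).1 hj
      exact ⟨hjB, this.1, this.2.le.trans he.2⟩
  have hY : Jᶜ ⊆ M.closure (B ∩ Jᶜ) := by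
    intro e he
    by_cases heB : e ∈ B
    · exact M.mem_closure_of_mem' ⟨heB, he⟩ (hE ▸ mem_univ e)
    · have heB' : e ∉ necklace M (finRotate n k) := fun h => heB (hcompl.le ⟨h, he⟩).1
      refine M.closure_subset_closure ?_
        (mem_closure_of_notMem_necklace (hE ▸ mem_univ e) heB')
      rintro j ⟨hjB, hj⟩
      exact hcompl.le ⟨hjB, notMem_Icc_of_cycLT hak he hj⟩
  have hunion : ∀ I₁ I₂, M.Indep I₁ → M.Indep I₂ → I₁ ⊆ J → I₂ ⊆ Jᶜ → M.Indep (I₁ ∪ I₂) := by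
    intro I₁ I₂ hI₁ hI₂ h1 h2
    have hbX : M.IsBasis (B ∩ J) J :=
      (hB.indep.subset inter_subset_left).isBasis_of_subset_of_subset_closure
        inter_subset_right hX
    have hbY : M.IsBasis (B ∩ Jᶜ) Jᶜ :=
      (hB.indep.subset inter_subset_left).isBasis_of_subset_of_subset_closure
        inter_subset_right hY
    obtain ⟨X, hXb, hX1⟩ := hI₁.subset_isBasis_of_subset h1 (by rw [hE]; exact subset_univ _)
    obtain ⟨Y, hYb, hY2⟩ := hI₂.subset_isBasis_of_subset h2 (by rw [hE]; exact subset_univ _)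
    refine Matroid.Indep.subset ?_ (union_subset_union hX1 hY2)
    -- `X ∪ Y` spans and has the cardinality of the basis `B`
    have hspan : M.Spanning (X ∪ Y) := by
      rw [Matroid.spanning_iff_ground_subset_closure (by rw [hE]; exact subset_univ _), hE]
      intro e _
      by_cases he : e ∈ J
      · exact M.closure_subset_closure subset_union_left (hXb.subset_closure he)
      · exact M.closure_subset_closure subset_union_right (hYb.subset_closure he)
    obtain ⟨B', hB', hB'sub⟩ := hspan.exists_isBase_subset
    have hc1 : X.ncard = (B ∩ J).ncard := by
      rw [ncard_def, ncard_def, hXb.encard_eq_encard hbX]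
    have hc2 : Y.ncard = (B ∩ Jᶜ).ncard := by
      rw [ncard_def, ncard_def, hYb.encard_eq_encard hbY]
    have hc3 : (B ∩ J).ncard + (B ∩ Jᶜ).ncard = B.ncard := by
      rw [← sdiff_eq]; exact ncard_inter_add_ncard_sdiff_eq_ncard _ _
    have hc4 := hB.ncard_eq_ncard_of_isBase hB'
    have hc5 := ncard_union_le X Y
    rw [← eq_of_subset_of_ncard_le hB'sub (by omega) (toFinite _)]
    exact hB'.indep
  intro C hC u hu v hv huJ
  by_contra hvJ
  have := hunion (C ∩ J) (C ∩ Jᶜ)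
    (hC.ssubset_indep ⟨inter_subset_left, fun h => hvJ (h hv).2⟩)
    (hC.ssubset_indep ⟨inter_subset_left, fun h => (h hu).2 huJ⟩)
    inter_subset_right inter_subset_right
  rw [inter_union_compl] at this
  exact hC.not_indep this

end Necklace

/-! ### Non-crossing partitions -/

section NonCrossing

variable {n : ℕ}

/-- A polynomial in the labels whose sign tells on which side of the chord `{a, c}` the vertex `x`
lies: it is negative for `x` between `a` and `c`, positive for `x` outside, zero at `a` and `c`. -/
def chordSide (a c x : Fin n) : ℝ := ((x : ℝ) - a) * ((x : ℝ) - c)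

theorem chordSide_ne_zero {a c x : Fin n} (ha : x ≠ a) (hc : x ≠ c) : chordSide a c x ≠ 0 := by
  refine mul_ne_zero (sub_ne_zero.2 fun h => ha (Fin.ext ?_)) (sub_ne_zero.2 fun h => hc (Fin.ext ?_))
    <;> exact_mod_cast h

theorem chordSide_mul_comm (a b c d : Fin n) :
    chordSide a c b * chordSide a c d = chordSide b d a * chordSide b d c := by
  simp only [chordSide]; ring

theorem InCyclicOrder.chordSide_mul_neg {a b c d : Fin n} (h : InCyclicOrder a b c d) :
    chordSide a c b * chordSide a c d < 0 := by
  have key : ∀ w x y z : Fin n, w < x → x < y → y < z →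
      chordSide w y x * chordSide w y z < 0 := by
    intro w x y z h1 h2 h3
    have h1' : (w : ℝ) < x := by exact_mod_cast h1
    have h2' : (x : ℝ) < y := by exact_mod_cast h2
    have h3' : (y : ℝ) < z := by exact_mod_cast h3
    exact mul_neg_of_neg_of_pos
      (mul_neg_of_pos_of_neg (by linarith) (by linarith)) (mul_pos (by linarith) (by linarith))
  have hs : ∀ u v x : Fin n, chordSide u v x = chordSide v u x := fun _ _ _ => mul_comm _ _
  rcases h with ⟨h1, h2, h3⟩ | ⟨h1, h2, h3⟩ | ⟨h1, h2, h3⟩ | ⟨h1, h2, h3⟩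
  · exact key _ _ _ _ h1 h2 h3
  · have := key _ _ _ _ h1 h2 h3
    rwa [chordSide_mul_comm, mul_comm]
  · have := key _ _ _ _ h1 h2 h3
    rwa [hs c a, hs c a, mul_comm] at this
  · have := key _ _ _ _ h1 h2 h3
    rwa [hs d b, hs d b, ← chordSide_mul_comm] at this

variable {P : Set (Set (Fin n))}

theorem IsNonCrossingPartition.between (hP : IsNonCrossingPartition P) {S T : Set (Fin n)}
    (hS : S ∈ P) (hT : T ∈ P) (hST : S ≠ T) {p q z w : Fin n} (hp : p ∈ S) (hq : q ∈ S)
    (hz : z ∈ T) (hw : w ∈ T) (hpz : p < z) (hzq : z < q) : p < w ∧ w < q := by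
  have hne : ∀ x ∈ S, x ≠ w := by
    rintro x hx rfl
    exact hST ((hP.1.2 x).unique ⟨hS, hx⟩ ⟨hT, hw⟩)
  have hnc := hP.2 S hS T hT hST
  constructor
  · by_contra h
    exact hnc ⟨p, z, q, w, Or.inr (Or.inr (Or.inr
      ⟨lt_of_le_of_ne (not_lt.1 h) (hne p hp).symm, hpz, hzq⟩)), hp, hq, hz, hw⟩
  · by_contra h
    exact hnc ⟨p, z, q, w, Or.inl ⟨hpz, hzq, lt_of_le_of_ne (not_lt.1 h) (hne q hq)⟩,
      hp, hq, hz, hw⟩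

/-- Two elements in different blocks of a non-crossing partition are separated by an interval that
is a union of blocks: a gap between two consecutive elements of the block of `i`, or the convex hull
of that block. -/
theorem IsNonCrossingPartition.exists_Icc (hP : IsNonCrossingPartition P) {T : Set (Fin n)}
    (hT : T ∈ P) {i j : Fin n} (hi : i ∈ T) (hj : j ∉ T) :
    ∃ a k : Fin n, a ≤ k ∧
      (∀ U ∈ P, ∀ z ∈ U, ∀ w ∈ U, z ∈ Icc a k → w ∈ Icc a k) ∧
      ¬ (i ∈ Icc a k ↔ j ∈ Icc a k) := by
  by_cases hgap : (∃ p ∈ T, p < j) ∧ ∃ q ∈ T, j < q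
  · obtain ⟨⟨p₀, hp₀⟩, ⟨q₀, hq₀⟩⟩ := hgap
    obtain ⟨p, hp, hpmax⟩ := exists_max_image {p | p ∈ T ∧ p < j} id (toFinite _) ⟨p₀, hp₀⟩
    obtain ⟨q, hq, hqmin⟩ := exists_min_image {q | q ∈ T ∧ j < q} id (toFinite _) ⟨q₀, hq₀⟩
    have hpj := Fin.lt_def.1 hp.2
    have hjq := Fin.lt_def.1 hq.2
    have hmem : ∀ x : Fin n, x ∈ Icc (⟨p + 1, by omega⟩ : Fin n) ⟨q - 1, by omega⟩ ↔
        p < x ∧ x < q := by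
      intro x
      simp only [mem_Icc, Fin.le_def, Fin.lt_def]
      omega
    have hdisj : ∀ x ∈ T, ¬ (p < x ∧ x < q) := by
      rintro x hx ⟨h1, h2⟩
      rcases lt_trichotomy x j with h | rfl | h
      · exact absurd (hpmax x ⟨hx, h⟩) (not_le.2 h1)
      · exact hj hx
      · exact absurd (hqmin x ⟨hx, h⟩) (not_le.2 h2)
    refine ⟨⟨p + 1, by omega⟩, ⟨q - 1, by omega⟩, Fin.le_def.2 (by simp only; omega), ?_, ?_⟩
    · intro U hU z hz w hw hzI
      rw [hmem] at hzI ⊢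
      refine hP.between hT hU ?_ hp.1 hq.1 hz hw hzI.1 hzI.2
      rintro rfl
      exact hdisj z hz hzI
    · rw [hmem, hmem]
      exact fun h => hdisj i hi (h.2 ⟨hp.2, hq.2⟩)
  · obtain ⟨p, hp, hpmin⟩ := exists_min_image T id (toFinite _) ⟨i, hi⟩
    obtain ⟨q, hq, hqmax⟩ := exists_max_image T id (toFinite _) ⟨i, hi⟩
    have hhull : ∀ x ∈ T, x ∈ Icc p q := fun x hx => ⟨hpmin x hx, hqmax x hx⟩
    refine ⟨p, q, hpmin q hq, ?_, ?_⟩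
    · intro U hU z hz w hw hzI
      by_cases hTU : T = U
      · exact hhull w (hTU ▸ hw)
      · have hne : ∀ x ∈ T, x ≠ z := by
          rintro x hx rfl
          exact hTU ((hP.1.2 x).unique ⟨hT, hx⟩ ⟨hU, hz⟩)
        have := hP.between hT hU hTU hp hq hz hw (lt_of_le_of_ne hzI.1 (hne p hp))
          (lt_of_le_of_ne hzI.2 (hne q hq).symm)
        exact ⟨this.1.le, this.2.le⟩
    · intro h
      have hjI := h.1 (hhull i hi)
      have hne : ∀ x ∈ T, x ≠ j := by
        rintro x hx rfl
        exact hj hx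
      exact hgap ⟨⟨p, hp, lt_of_le_of_ne hjI.1 (hne p hp)⟩,
        ⟨q, hq, lt_of_le_of_ne hjI.2 (hne q hq).symm⟩⟩

/-- The components of `M` refine every non-crossing partition with `π`-invariant blocks: otherwise
one of the intervals separating two elements of a component is invariant, hence a separator. -/
theorem componentBlocks_refines {M : Matroid (Fin n)} (hE : M.E = univ)
    (hP : IsNonCrossingPartition P)
    (hπ : ∀ i : Fin n, ∃ S ∈ P, i ∈ S ∧ (decoratedPerm M).perm i ∈ S) :
    Refines (componentBlocks M) P := by
  rw [componentBlocks_eq_classes hE]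
  rintro S ⟨i, rfl⟩
  obtain ⟨T, hT, hi, -⟩ := hπ i
  refine ⟨T, hT, fun j hj => ?_⟩
  by_contra hjT
  obtain ⟨a, k, hak, hinv, hsep⟩ := hP.exists_Icc hT hi hjT
  refine hsep ((compSetoid M).symm hj _ (isSeparator_Icc hE hak fun x hx => ?_))
  obtain ⟨U, hU, hxU, hxU'⟩ := hπ x
  exact hinv U hU _ hxU' x hxU hx

end NonCrossing

/-! ### Components of a positroid do not cross -/

section TotallyNonneg

variable {n d : ℕ}

/-- Total nonnegativity for columns in arbitrary order: a Vandermonde determinant records the sign of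
the permutation that sorts them. -/
theorem IsTotallyNonneg.det_mul_vandermonde_nonneg {A : Matrix (Fin d) (Fin n) ℝ}
    (hA : IsTotallyNonneg A) (g : Fin d → Fin n) :
    0 ≤ (A.submatrix id g).det * (Matrix.vandermonde fun i => (g i : ℝ)).det := by
  by_cases hg : Function.Injective g
  · have hmono : StrictMono (g ∘ Tuple.sort g) :=
      (Tuple.monotone_sort g).strictMono_of_injective (hg.comp (Tuple.sort g).injective)
    have h1 := hA.2 (OrderEmbedding.ofStrictMono _ hmono)
    have h2 : 0 ≤ (Matrix.vandermonde fun i => ((g ∘ Tuple.sort g) i : ℝ)).det := by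
      rw [Matrix.det_vandermonde]
      refine Finset.prod_nonneg fun i _ => Finset.prod_nonneg fun j hj => sub_nonneg.2 ?_
      exact_mod_cast (hmono (Finset.mem_Ioi.1 hj)).le
    have h3 : (A.submatrix id (OrderEmbedding.ofStrictMono _ hmono)).det =
        (Equiv.Perm.sign (Tuple.sort g) : ℤ) * (A.submatrix id g).det :=
      Matrix.det_permute' (Tuple.sort g) (A.submatrix id g)
    have h4 : (Matrix.vandermonde fun i => ((g ∘ Tuple.sort g) i : ℝ)).det =
        (Equiv.Perm.sign (Tuple.sort g) : ℤ) * (Matrix.vandermonde fun i => (g i : ℝ)).det :=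
      Matrix.det_permute (Tuple.sort g) (Matrix.vandermonde fun i => (g i : ℝ))
    have h5 := mul_nonneg h1 h2
    rw [h3, h4] at h5
    rcases Int.units_eq_one_or (Equiv.Perm.sign (Tuple.sort g)) with h | h <;>
      · rw [h] at h5
        simpa using h5
  · obtain ⟨i, j, hij, hne⟩ := Function.not_injective_iff.1 hg
    rw [Matrix.det_zero_of_column_eq hne (fun k => by simp [hij]), zero_mul]

theorem det_vandermonde_cons_cons {m : ℕ} (x y : ℝ) (w : Fin m → ℝ) :
    (Matrix.vandermonde (Fin.cons x (Fin.cons y w : Fin (m + 1) → ℝ) : Fin (m + 2) → ℝ)).det =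
      (y - x) * (∏ k, (w k - x)) * (∏ k, (w k - y)) * (Matrix.vandermonde w).det := by
  simp only [Matrix.det_vandermonde, Fin.prod_univ_succ, Fin.prod_Ioi_zero, Fin.prod_Ioi_succ,
    Fin.cons_zero, Fin.cons_succ]
  ring

/-- The determinant as a bilinear form in its first two rows. -/
noncomputable def detForm {m : ℕ} (w : Fin m → Fin (m + 2) → ℝ) (u u' : Fin (m + 2) → ℝ) : ℝ :=
  ((Matrix.detRowAlternating.curryLeft u).curryLeft u') w

theorem detForm_eq {m : ℕ} (w : Fin m → Fin (m + 2) → ℝ) (u u' : Fin (m + 2) → ℝ) :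
    detForm w u u' = (Matrix.of (Fin.cons u (Fin.cons u' w : Fin (m + 1) → _))).det := rfl

theorem detForm_swap {m : ℕ} (w : Fin m → Fin (m + 2) → ℝ) (u u' : Fin (m + 2) → ℝ) :
    detForm w u' u = - detForm w u u' := by
  rw [detForm_eq, detForm_eq]
  have := (Matrix.detRowAlternating (n := Fin (m + 2)) (R := ℝ)).map_swap
    (Fin.cons u (Fin.cons u' w : Fin (m + 1) → _)) (show (0 : Fin (m + 2)) ≠ 1 by simp)
  refine Eq.trans (congrArg Matrix.detRowAlternating ?_) this
  funext i
  refine Fin.cases ?_ (fun i => Fin.cases ?_ (fun i => ?_) i) i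
  · simp [Equiv.swap_apply_left]
    rfl
  · simp [Equiv.swap_apply_right]
    rfl
  · rw [Function.comp_apply, Equiv.swap_apply_of_ne_of_ne]
    · rfl
    · exact Fin.succ_ne_zero _
    · rw [← Fin.succ_zero_eq_one]
      exact fun h => Fin.succ_ne_zero _ (Fin.succ_injective _ h)

theorem exists_detForm_eq_add {m : ℕ} {w : Fin m → Fin (m + 2) → ℝ} {u₁ u₂ v : Fin (m + 2) → ℝ}
    (hv : v ∈ Submodule.span ℝ (insert u₁ (insert u₂ (range w)))) :
    ∃ s t : ℝ, ∀ u', detForm w v u' = s * detForm w u₁ u' + t * detForm w u₂ u' := by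
  obtain ⟨s, z', hz', rfl⟩ := Submodule.mem_span_insert.1 hv
  obtain ⟨t, z, hz, rfl⟩ := Submodule.mem_span_insert.1 hz'
  refine ⟨s, t, fun u' => ?_⟩
  have h0 : detForm w z u' = 0 := by
    clear hv hz'
    induction hz using Submodule.span_induction with
    | mem x hx =>
      obtain ⟨k, rfl⟩ := hx
      rw [detForm_eq]
      exact Matrix.det_zero_of_row_eq (i := 0) (j := k.succ.succ) (Fin.succ_ne_zero _).symm rfl
    | zero => simp [detForm]
    | add x y _ _ hx hy => 
      have : detForm w (x + y) u' = detForm w x u' + detForm w y u' := by simp [detForm]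
      rw [this, hx, hy, add_zero]
    | smul s x _ hx => 
      have : detForm w (s • x) u' = s * detForm w x u' := by simp [detForm]
      rw [this, hx, mul_zero]
  have : detForm w (s • u₁ + (t • u₂ + z)) u' =
      s * detForm w u₁ u' + (t * detForm w u₂ u' + detForm w z u') := by
    simp [detForm]
  rw [this, h0, add_zero]

/-- The instance of the three-term Plücker relation in which one of the three terms vanishes. -/
theorem detForm_mul_eq_of_eq_zero {m : ℕ} {w : Fin m → Fin (m + 2) → ℝ}
    {a b c d : Fin (m + 2) → ℝ} (hab : detForm w a b ≠ 0) (hca : detForm w c a = 0)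
    (hc : c ∈ Submodule.span ℝ (insert a (insert b (range w)))) :
    detForm w a b * detForm w c d = detForm w c b * detForm w a d := by
  obtain ⟨s, t, h⟩ := exists_detForm_eq_add hc
  have hself : ∀ u, detForm w u u = 0 := fun u => by
    have := detForm_swap w u u
    linarith
  have ht : t = 0 := by
    have h1 := h a
    rw [hca, hself, mul_zero, zero_add, detForm_swap] at h1
    exact (mul_eq_zero.1 h1.symm).resolve_right (neg_ne_zero.2 hab)
  subst ht
  rw [h d, h b]
  ring

theorem isBase_range_iff {M : Matroid (Fin n)} {A : Matrix (Fin d) (Fin n) ℝ}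
    (hM : IsMatroidOf M A) {g : Fin d → Fin n} (hg : Function.Injective g) :
    M.IsBase (range g) ↔ (A.submatrix id g).det ≠ 0 := by
  have hiff : LinearIndepOn ℝ A.col (range g) ↔ (A.submatrix id g).det ≠ 0 := by
    rw [linearIndepOn_range_iff hg, ← isUnit_iff_ne_zero, ← Matrix.isUnit_iff_isUnit_det,
      ← Matrix.linearIndependent_cols_iff_isUnit]
    rfl
  rw [hM.2, ← hiff]
  refine and_iff_left_of_imp fun h => ?_
  rw [← range_comp]
  exact ((linearIndepOn_range_iff hg _).1 h).span_eq_top_of_card_eq_finrank' (by simp)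

variable {M : Matroid (Fin n)} {A : Matrix (Fin d) (Fin n) ℝ}

/-- Exchanges in two non-crossing directions: the three-term Plücker relation forces the chords
`{a, c}` and `{b, d}` not to cross. -/
theorem chordSide_mul_nonneg_of_exchange (hA : IsTotallyNonneg A) (hM : IsMatroidOf M A)
    {W : Set (Fin n)} {a b c e : Fin n} (haW : a ∉ W) (hbW : b ∉ W) (hcW : c ∉ W) (heW : e ∉ W)
    (hab : a ≠ b) (hcb : c ≠ b) (hae : a ≠ e) (hca : c ≠ a)
    (h1 : M.IsBase (insert a (insert b W))) (h2 : M.IsBase (insert c (insert b W)))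
    (h3 : M.IsBase (insert a (insert e W))) (h4 : ¬ M.IsBase (insert c (insert a W))) :
    0 ≤ chordSide a c b * chordSide a c e := by
  obtain ⟨m, w, hw, hwW⟩ : ∃ (m : ℕ) (w : Fin m → Fin n), Function.Injective w ∧ range w = W := by
    let φ := Finite.equivFin W
    refine ⟨_, fun i => (φ.symm i : Fin n),
      Subtype.val_injective.comp φ.symm.injective, ?_⟩
    have := φ.symm.surjective.range_comp (fun x : W => (x : Fin n))
    rw [Subtype.range_coe] at this
    exact this
  have hrange : ∀ x y : Fin n, range (Fin.cons x (Fin.cons y w : Fin (m + 1) → Fin n) :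
      Fin (m + 2) → Fin n) = insert x (insert y W) := by
    intro x y
    rw [Fin.range_cons, Fin.range_cons, hwW]
  have hinj : ∀ x y : Fin n, x ∉ W → y ∉ W → x ≠ y → Function.Injective
      (Fin.cons x (Fin.cons y w : Fin (m + 1) → Fin n) : Fin (m + 2) → Fin n) := by
    intro x y hx hy hxy
    rw [Fin.cons_injective_iff, Fin.cons_injective_iff, Fin.range_cons, hwW]
    exact ⟨fun h => h.elim hxy hx, hy, hw⟩
  have hdim : d = m + 2 := by
    have hb := (hM.2 _).1 h1
    rw [← hrange, linearIndepOn_range_iff (hinj a b haW hbW hab), ← range_comp] at hb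
    have := Module.finrank_eq_card_basis (Module.Basis.mk hb.1 hb.2.ge)
    simpa using this
  subst hdim
  set q : Fin n → Fin n → ℝ := fun x y => detForm (A.col ∘ w) (A.col x) (A.col y) with hq
  have hqdet : ∀ x y, q x y = (A.submatrix id
      (Fin.cons x (Fin.cons y w : Fin (m + 1) → Fin n) : Fin (m + 2) → Fin n)).det := by
    intro x y
    rw [hq, ← Matrix.det_transpose]
    simp only [detForm_eq]
    congr 1
    ext i j
    refine Fin.cases rfl (fun i => Fin.cases rfl (fun i => rfl) i) i
  have hqbase : ∀ x y, x ∉ W → y ∉ W → x ≠ y →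
      (M.IsBase (insert x (insert y W)) ↔ q x y ≠ 0) := by
    intro x y hx hy hxy
    rw [hqdet, ← isBase_range_iff hM (hinj x y hx hy hxy), hrange]
  have hqab := (hqbase a b haW hbW hab).1 h1
  have hqcb := (hqbase c b hcW hbW hcb).1 h2
  have hqae := (hqbase a e haW heW hae).1 h3
  have hqca : q c a = 0 := not_not.1 (fun h => h4 ((hqbase c a hcW haW hca).2 h))
  have hpl : q a b * q c e = q c b * q a e := by
    refine detForm_mul_eq_of_eq_zero hqab hqca ?_
    have := ((hM.2 _).1 h1).2
    rw [image_insert_eq, image_insert_eq, ← hwW, ← range_comp] at this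
    rw [this]
    trivial
  set p : Fin n → ℝ := fun x => ∏ k, ((w k : ℝ) - x) with hp
  have hp0 : ∀ x, x ∉ W → p x ≠ 0 := by
    intro x hx
    refine Finset.prod_ne_zero_iff.2 fun k _ => sub_ne_zero.2 fun h => hx ?_
    rw [← hwW]
    exact ⟨k, Fin.ext (by exact_mod_cast h)⟩
  set κ : ℝ := (Matrix.vandermonde fun i => (w i : ℝ)).det with hκ
  have hκ0 : κ ≠ 0 := by
    rw [hκ, Matrix.det_vandermonde_ne_zero_iff]
    intro i j hij
    exact hw (Fin.ext (Nat.cast_injective hij))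
  have hpos : ∀ x y, 0 ≤ q x y * (((y : ℝ) - x) * p x * p y * κ) := by
    intro x y
    have := hA.det_mul_vandermonde_nonneg
      (Fin.cons x (Fin.cons y w : Fin (m + 1) → Fin n) : Fin (m + 2) → Fin n)
    rw [← hqdet] at this
    rw [hp, hκ, ← det_vandermonde_cons_cons]
    convert this using 5 with i
    refine Fin.cases rfl (fun i => Fin.cases rfl (fun i => rfl) i) i
  -- by `hpl`, the product of these four sign conditions is the claim times a positive square
  have hprod := mul_nonneg (mul_nonneg (hpos a b) (hpos c e)) (mul_nonneg (hpos c b) (hpos a e))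
  have hfac : 0 < (q a b * q c e * (p a * p b * p c * p e * κ ^ 2)) ^ 2 := by
    have := hp0 a haW; have := hp0 b hbW; have := hp0 c hcW; have := hp0 e heW
    rw [hpl]
    positivity
  refine nonneg_of_mul_nonneg_right (a := (q a b * q c e * (p a * p b * p c * p e * κ ^ 2)) ^ 2)
    ?_ hfac
  refine hprod.trans_eq ?_
  simp only [chordSide]
  linear_combination (-(q a b * q c e) * ((p a * p b * p c * p e * κ ^ 2)) ^ 2 *
    (((b : ℝ) - a) * (b - c) * ((e - a) * (e - c)))) * hpl

end TotallyNonneg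

section Crossing

variable {n d : ℕ} {M : Matroid (Fin n)} {A : Matrix (Fin d) (Fin n) ℝ}

/-- Circuits in different components of a positroid do not cross. -/
theorem chordSide_mul_nonneg_of_isCircuit (hA : IsTotallyNonneg A) (hM : IsMatroidOf M A)
    {C C' : Set (Fin n)} (hC : M.IsCircuit C) (hC' : M.IsCircuit C') {a b c e : Fin n}
    (ha : a ∈ C) (hc : c ∈ C) (hb : b ∈ C') (he : e ∈ C') (hab : ¬ compSetoid M a b) :
    0 ≤ chordSide a c b * chordSide a c e := by
  rcases eq_or_ne a c with rfl | hac
  · exact mul_nonneg (mul_self_nonneg _) (mul_self_nonneg _)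
  rcases eq_or_ne b e with rfl | hbe
  · exact mul_self_nonneg _
  have hCa : ∀ x ∈ C, compSetoid M a x := fun x hx => compSetoid_of_isCircuit hC ha hx
  have hCb : ∀ x ∈ C', compSetoid M x b := fun x hx => compSetoid_of_isCircuit hC' hx hb
  have hdisj : ∀ x ∈ C, x ∉ C' := fun x hx hx' => hab ((compSetoid M).trans (hCa x hx) (hCb x hx'))
  have hne : ∀ x ∈ C, ∀ y ∈ C', x ≠ y := fun x hx y hy h => hdisj x hx (h ▸ hy)
  have hIE : C \ {c} ∪ C' \ {e} ⊆ M.E := union_subset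
    (sdiff_subset.trans hC.subset_ground) (sdiff_subset.trans hC'.subset_ground)
  have hI : M.Indep (C \ {c} ∪ C' \ {e}) := by
    by_contra hcon
    obtain ⟨D, hDI, hD⟩ := ((Matroid.not_indep_iff hIE).1 hcon).exists_isCircuit_subset
    obtain ⟨x, hx⟩ := hD.nonempty
    rcases hDI hx with hxC | hxC
    · refine hD.not_indep ((hC.sdiff_singleton_indep hc).subset fun y hy => ?_)
      rcases hDI hy with hyC | hyC
      · exact hyC
      · exact absurd ((compSetoid M).trans (hCa x hxC.1) ((compSetoid M).trans
          (compSetoid_of_isCircuit hD hx hy) (hCb y hyC.1))) hab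
    · refine hD.not_indep ((hC'.sdiff_singleton_indep he).subset fun y hy => ?_)
      rcases hDI hy with hyC | hyC
      · exact absurd ((compSetoid M).trans (hCa y hyC.1) ((compSetoid M).trans
          (compSetoid_of_isCircuit hD hy hx) (hCb x hxC.1))) hab
      · exact hyC
  -- `C` and `C'` are the fundamental circuits of `c` and `e` with respect to any basis `B` containing this set
  obtain ⟨B, hB, hIB⟩ := hI.exists_isBase_superset
  have hBC : ∀ x ∈ C, x ≠ c → x ∈ B := fun x hx hxc => hIB (Or.inl ⟨hx, hxc⟩)
  have hBC' : ∀ x ∈ C', x ≠ e → x ∈ B := fun x hx hxe => hIB (Or.inr ⟨hx, hxe⟩)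
  have hcB : c ∉ B := fun h => hC.not_indep (hB.indep.subset fun x hx => by
    by_cases hxc : x = c
    · exact hxc ▸ h
    · exact hBC x hx hxc)
  have heB : e ∉ B := fun h => hC'.not_indep (hB.indep.subset fun x hx => by
    by_cases hxe : x = e
    · exact hxe ▸ h
    · exact hBC' x hx hxe)
  have haB : a ∈ B := hBC a ha hac
  have hbB : b ∈ B := hBC' b hb hbe
  have hexch : ∀ {D : Set (Fin n)} {x y : Fin n}, M.IsCircuit D → x ∈ D → y ∈ D → y ∉ B → x ≠ y →
      D ⊆ insert y B → M.IsBase (insert y (B \ {x})) := by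
    intro D x y hD hx hy hyB hxy hDB
    have hcl : y ∈ M.closure B := by
      rw [hB.closure_eq]; exact hD.subset_ground hy
    have hfund := hD.eq_fundCircuit_of_subset hB.indep hDB
    have := (hB.indep.mem_fundCircuit_iff hcl hyB).1 (hfund ▸ hx)
    refine hB.exchange_isBase_of_indep hyB ?_
    rwa [insert_sdiff_singleton_comm hxy.symm]
  have h2 := hexch hC ha hc hcB hac fun x hx => by
    by_cases hxc : x = c
    · exact Or.inl hxc
    · exact Or.inr (hBC x hx hxc)
  have h3 := hexch hC' hb he heB hbe fun x hx => by
    by_cases hxe : x = e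
    · exact Or.inl hxe
    · exact Or.inr (hBC' x hx hxe)
  have hab' := hne a ha b hb
  refine chordSide_mul_nonneg_of_exchange hA hM (W := B \ {a, b}) (fun h => h.2 (Or.inl rfl))
    (fun h => h.2 (Or.inr rfl)) (fun h => hcB h.1) (fun h => heB h.1) hab' (hne c hc b hb)
    (hne a ha e he) hac.symm ?_ ?_ ?_ ?_
  · convert hB
    ext x
    by_cases hxa : x = a <;> by_cases hxb : x = b <;> simp_all
  · convert h2 using 2
    ext x
    by_cases hxa : x = a <;> by_cases hxb : x = b <;> simp_all
  · rw [insert_comm]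
    convert h3 using 2
    ext x
    by_cases hxa : x = a <;> by_cases hxb : x = b <;> simp_all
  · intro h
    refine hC.not_indep (h.indep.subset fun x hx => ?_)
    by_cases hxc : x = c
    · exact Or.inl hxc
    by_cases hxa : x = a
    · exact Or.inr (Or.inl hxa)
    · exact Or.inr (Or.inr ⟨hBC x hx hxc, fun h => h.elim hxa (hne x hx b hb)⟩)

/-- A function without zeros on a component that takes both signs there also takes both signs on a
single circuit: otherwise its positivity set would cut out a separator. -/
theorem exists_isCircuit_mul_neg {α : Type*} {M : Matroid α} {f : α → ℝ} {x y : α}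
    (hxy : compSetoid M x y) (hf : ∀ z, compSetoid M z x → f z ≠ 0) (hneg : f x * f y < 0) :
    ∃ C, M.IsCircuit C ∧ (∀ z ∈ C, compSetoid M z x) ∧ ∃ u ∈ C, ∃ v ∈ C, f u * f v < 0 := by
  by_contra! hcon
  have hsep : IsSeparator M {z | compSetoid M z x ∧ 0 < f x * f z} := by
    intro C hC u hu v hv ⟨hux, hpos⟩
    have hCx : ∀ z ∈ C, compSetoid M z x := fun z hz =>
      (compSetoid M).trans (compSetoid_of_isCircuit hC hz hu) hux
    refine ⟨hCx v hv, ?_⟩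
    have h1 := hcon C hC hCx u hu v hv
    have h2 := hf u hux
    have h3 := hf v (hCx v hv)
    have h4 := hf x ((compSetoid M).refl x)
    have h5 : 0 ≤ (f u) ^ 2 * (f x * f v) := by
      have := mul_nonneg hpos.le h1
      nlinarith
    exact lt_of_le_of_ne (nonneg_of_mul_nonneg_right h5 (by positivity)) (mul_ne_zero h4 h3).symm
  have := ((hxy _ hsep).1 ⟨(compSetoid M).refl x, 
    mul_self_pos.2 (hf x ((compSetoid M).refl x))⟩).2
  linarith

theorem chordSide_mul_nonneg_of_compSetoid (hA : IsTotallyNonneg A) (hM : IsMatroidOf M A)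
    {a b c e : Fin n} (hac : compSetoid M a c) (hbe : compSetoid M b e)
    (hab : ¬ compSetoid M a b) : 0 ≤ chordSide a c b * chordSide a c e := by
  by_contra! hneg
  have hne : ∀ x y, compSetoid M x a → compSetoid M y b → x ≠ y := by
    rintro x _ hx hy rfl
    exact hab ((compSetoid M).trans ((compSetoid M).symm hx) hy)
  -- pass to a circuit through `b'` and `e'` crossing `{a, c}`, then to one crossing `{b', e'}`
  obtain ⟨C', hC', hC'b, b', hb', e', he', hneg'⟩ := exists_isCircuit_mul_neg hbe
    (fun z hz => chordSide_ne_zero (hne a z ((compSetoid M).refl a) hz).symm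
      (hne c z ((compSetoid M).symm hac) hz).symm) hneg
  rw [chordSide_mul_comm] at hneg'
  obtain ⟨C, hC, hCa, a', ha', c', hc', hneg''⟩ := exists_isCircuit_mul_neg hac
    (fun z hz => chordSide_ne_zero (hne z b' hz (hC'b b' hb')) (hne z e' hz (hC'b e' he'))) hneg'
  rw [chordSide_mul_comm] at hneg''
  refine absurd (chordSide_mul_nonneg_of_isCircuit hA hM hC hC' ha' hc' hb' he' fun h => ?_)
    (not_le.2 hneg'')
  exact hab ((compSetoid M).trans ((compSetoid M).symm (hCa a' ha'))
    ((compSetoid M).trans h (hC'b b' hb')))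

theorem isNonCrossingPartition_componentBlocks (hM : IsPositroid M) :
    IsNonCrossingPartition (componentBlocks M) := by
  obtain ⟨d, A, hA, hMA⟩ := hM
  rw [componentBlocks_eq_classes hMA.1]
  refine ⟨Setoid.isPartition_classes _, ?_⟩
  rintro _ ⟨x, rfl⟩ _ ⟨y, rfl⟩ hST ⟨a, b, c, e, hcyc, ha, hc, hb, he⟩
  have hxy : ¬ compSetoid M x y := fun h => hST (Set.ext fun z =>
    ⟨fun hz => (compSetoid M).trans hz h, fun hz => (compSetoid M).trans hz ((compSetoid M).symm h)⟩)
  refine absurd (chordSide_mul_nonneg_of_compSetoid hA hMA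
    ((compSetoid M).trans ha ((compSetoid M).symm hc))
    ((compSetoid M).trans hb ((compSetoid M).symm he)) fun h => hxy ?_)
    (not_le.2 hcyc.chordSide_mul_neg)
  exact (compSetoid M).trans ((compSetoid M).symm ha) ((compSetoid M).trans h hb)

end Crossing

/-! ### Chord diagrams -/

section Chord

/-- The point of the unit circle at clockwise angle `θ`. -/
noncomputable def rimPoint (θ : ℝ) : ℂ := Complex.exp (-(θ : ℂ) * Complex.I)

theorem rimPoint_re (θ : ℝ) : (rimPoint θ).re = Real.cos θ := by
  rw [rimPoint, ← Complex.ofReal_neg, Complex.exp_ofReal_mul_I_re, Real.cos_neg]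

theorem rimPoint_im (θ : ℝ) : (rimPoint θ).im = -Real.sin θ := by
  rw [rimPoint, ← Complex.ofReal_neg, Complex.exp_ofReal_mul_I_im, Real.sin_neg]

/-- The affine function that vanishes on the line through `rimPoint α` and `rimPoint β`, normalized
so that its linear part has norm one. For `α = β` it vanishes on the tangent line. -/
noncomputable def lineSide (α β : ℝ) (z : ℂ) : ℝ :=
  Real.cos ((α - β) / 2) - (z.re * Real.cos ((α + β) / 2) - z.im * Real.sin ((α + β) / 2))

theorem continuous_lineSide (α β : ℝ) : Continuous (lineSide α β) := by
  unfold lineSide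
  fun_prop

theorem lineSide_rimPoint (α β θ : ℝ) :
    lineSide α β (rimPoint θ) = 2 * (Real.sin ((θ - α) / 2) * Real.sin ((θ - β) / 2)) := by
  have h1 : (α - β) / 2 = (θ - β) / 2 - (θ - α) / 2 := by ring
  have h2 : Real.cos θ * Real.cos ((α + β) / 2) + Real.sin θ * Real.sin ((α + β) / 2) =
      Real.cos ((θ - β) / 2 + (θ - α) / 2) := by
    rw [← Real.cos_sub]
    congr 1
    ring
  rw [lineSide, rimPoint_re, rimPoint_im, h1, neg_mul, sub_neg_eq_add, h2, Real.cos_sub,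
    Real.cos_add]
  ring

theorem lineSide_mul_nonpos_of_mem_segment {α β : ℝ} {p q z : ℂ} (hz : z ∈ segment ℝ p q)
    (h0 : lineSide α β z = 0) : lineSide α β p * lineSide α β q ≤ 0 := by
  obtain ⟨s, t, hs, ht, hst, rfl⟩ := hz
  have hcomb : s * lineSide α β p + t * lineSide α β q = 0 := by
    rw [← h0]
    -- the constant term is compatible with the combination because `s + t = 1`
    simp only [lineSide, Complex.add_re, Complex.add_im, Complex.real_smul, Complex.re_ofReal_mul,
      Complex.im_ofReal_mul]
    linear_combination (Real.cos ((α - β) / 2)) * hst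
  by_contra! hpos
  have hp : lineSide α β p ≠ 0 := fun h => by simp [h] at hpos
  have h1 : s * lineSide α β p ^ 2 + t * (lineSide α β p * lineSide α β q) = 0 := by
    linear_combination lineSide α β p * hcomb
  have h2 : 0 < lineSide α β p ^ 2 := by positivity
  rcases hs.eq_or_lt with rfl | hs
  · rw [zero_add] at hst
    subst hst
    linarith
  · have := mul_pos hs h2
    have := mul_nonneg ht hpos.le
    linarith

/-- A line meets the closed unit disk in the chord that it cuts out. -/
theorem mem_segment_of_lineSide_eq_zero {α β : ℝ} {z : ℂ} (hsin : Real.sin ((α - β) / 2) ≠ 0)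
    (hz : ‖z‖ ≤ 1) (h0 : lineSide α β z = 0) : z ∈ segment ℝ (rimPoint α) (rimPoint β) := by
  set m := (α + β) / 2 with hm
  set δ := (α - β) / 2 with hδ
  have hα : α = m + δ := by rw [hm, hδ]; ring
  have hβ : β = m - δ := by rw [hm, hδ]; ring
  have hm1 := Real.sin_sq_add_cos_sq m
  have hδ1 := Real.sin_sq_add_cos_sq δ
  have hk : z.re * Real.cos m - z.im * Real.sin m = Real.cos δ := by
    have : Real.cos δ - (z.re * Real.cos m - z.im * Real.sin m) = 0 := h0
    linarith
  have hnorm : z.re ^ 2 + z.im ^ 2 ≤ 1 := by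
    have h1 : ‖z‖ ^ 2 ≤ 1 := pow_le_one₀ (norm_nonneg z) hz
    rw [← Complex.normSq_eq_norm_sq, Complex.normSq_apply] at h1
    linarith
  -- the coordinate of `z` along the line, measured from the midpoint of the chord
  set s := z.re * Real.sin m + z.im * Real.cos m with hs
  have hsle : s ^ 2 ≤ Real.sin δ ^ 2 := by
    have : s ^ 2 + Real.cos δ ^ 2 = z.re ^ 2 + z.im ^ 2 := by
      rw [hs, ← hk]
      linear_combination (z.re ^ 2 + z.im ^ 2) * hm1
    linarith
  have habs : |s / Real.sin δ| ≤ 1 := by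
    rw [← sq_le_one_iff_abs_le_one, div_pow]
    exact div_le_one_of_le₀ hsle (sq_nonneg _)
  obtain ⟨hlo, hhi⟩ := abs_le.1 habs
  have hmul : s / Real.sin δ * Real.sin δ = s := div_mul_cancel₀ _ hsin
  refine ⟨(1 - s / Real.sin δ) / 2, (1 + s / Real.sin δ) / 2, by linarith, by linarith,
    by ring, ?_⟩
  rw [hα, hβ]
  apply Complex.ext
  · simp only [Complex.add_re, Complex.real_smul, Complex.re_ofReal_mul, rimPoint_re, Real.cos_add,
      Real.cos_sub]
    linear_combination Real.sin m * hmul - Real.cos m * hk + z.re * hm1 + Real.sin m * hs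
  · simp only [Complex.add_im, Complex.real_smul, Complex.im_ofReal_mul, rimPoint_im, Real.sin_add,
      Real.sin_sub]
    linear_combination Real.cos m * hmul + Real.sin m * hk + z.im * hm1 + Real.cos m * hs

theorem exists_lineSide_eq_zero_of_isPreconnected {X : Set ℂ} (hX : IsPreconnected X) {α β : ℝ}
    {p q : ℂ} (hp : p ∈ X) (hq : q ∈ X) (h : lineSide α β p * lineSide α β q < 0) :
    ∃ z ∈ X, lineSide α β z = 0 := by
  have hc := (continuous_lineSide α β).continuousOn (s := X)
  rcases mul_neg_iff.1 h with ⟨h1, h2⟩ | ⟨h1, h2⟩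
  · exact hX.intermediate_value hq hp hc ⟨h2.le, h1.le⟩
  · exact hX.intermediate_value hp hq hc ⟨h1.le, h2.le⟩

variable {n : ℕ}

theorem exists_sin_eq_mul {N x : ℝ} (h1 : -N < x) (h2 : x < N) :
    ∃ κ : ℝ, 0 < κ ∧ Real.sin (Real.pi * x / N) = κ * x := by
  have hN : 0 < N := by linarith
  have key : ∀ y, 0 < y → y < N → 0 < Real.sin (Real.pi * y / N) := fun y hy hyN =>
    Real.sin_pos_of_pos_of_lt_pi (by positivity)
      (by rw [div_lt_iff₀ hN]; exact mul_lt_mul_of_pos_left hyN Real.pi_pos)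
  rcases lt_trichotomy x 0 with hx | rfl | hx
  · refine ⟨Real.sin (Real.pi * x / N) / x, div_pos_of_neg_of_neg ?_ hx,
      (div_mul_cancel₀ _ hx.ne).symm⟩
    have := key (-x) (by linarith) (by linarith)
    rw [mul_neg, neg_div, Real.sin_neg] at this
    linarith
  · exact ⟨1, one_pos, by simp⟩
  · exact ⟨_, div_pos (key x hx h2) hx, (div_mul_cancel₀ _ hx.ne').symm⟩

/-- Up to a positive factor, `lineSide` at a vertex is a polynomial in the labels; half-integral
labels `s`, `t` are allowed for the line. -/
theorem exists_lineSide_circlePoint (x : Fin n) {s t : ℝ} (hs : |(x : ℝ) - s| < n)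
    (ht : |(x : ℝ) - t| < n) : ∃ κ : ℝ, 0 < κ ∧
      lineSide (2 * Real.pi * s / n) (2 * Real.pi * t / n) (circlePoint x) =
        κ * (((x : ℝ) - s) * (x - t)) := by
  obtain ⟨κ₁, h1, h1'⟩ := exists_sin_eq_mul (abs_lt.1 hs).1 (abs_lt.1 hs).2
  obtain ⟨κ₂, h2, h2'⟩ := exists_sin_eq_mul (abs_lt.1 ht).1 (abs_lt.1 ht).2
  refine ⟨2 * (κ₁ * κ₂), by positivity, ?_⟩
  have hcp : circlePoint x = rimPoint (2 * Real.pi * (x : ℝ) / n) := rfl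
  rw [hcp, lineSide_rimPoint,
    show (2 * Real.pi * (x : ℝ) / n - 2 * Real.pi * s / n) / 2 = Real.pi * (x - s) / n by ring,
    show (2 * Real.pi * (x : ℝ) / n - 2 * Real.pi * t / n) / 2 = Real.pi * (x - t) / n by ring,
    h1', h2']
  ring

theorem abs_sub_lt_of_fin (x y : Fin n) : |(x : ℝ) - y| < n := by
  have h1 : (x : ℝ) < n := by exact_mod_cast x.2
  have h2 : (y : ℝ) < n := by exact_mod_cast y.2
  have h3 : (0 : ℝ) ≤ (x : ℝ) := Nat.cast_nonneg _
  have h4 : (0 : ℝ) ≤ (y : ℝ) := Nat.cast_nonneg _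
  rw [abs_lt]
  constructor <;> linarith

theorem exists_lineSide_eq_chordSide (a c x : Fin n) : ∃ κ : ℝ, 0 < κ ∧
    lineSide (2 * Real.pi * (a : ℝ) / n) (2 * Real.pi * (c : ℝ) / n) (circlePoint x) =
      κ * chordSide a c x :=
  exists_lineSide_circlePoint x (abs_sub_lt_of_fin x a) (abs_sub_lt_of_fin x c)

theorem lineSide_mul_neg_iff (a c x y : Fin n) :
    lineSide (2 * Real.pi * (a : ℝ) / n) (2 * Real.pi * (c : ℝ) / n) (circlePoint x) *
      lineSide (2 * Real.pi * (a : ℝ) / n) (2 * Real.pi * (c : ℝ) / n) (circlePoint y) < 0 ↔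
    chordSide a c x * chordSide a c y < 0 := by
  obtain ⟨κ₁, h1, e1⟩ := exists_lineSide_eq_chordSide a c x
  obtain ⟨κ₂, h2, e2⟩ := exists_lineSide_eq_chordSide a c y
  rw [e1, e2, mul_mul_mul_comm]
  refine ⟨fun h => ?_, mul_neg_of_pos_of_neg (mul_pos h1 h2)⟩
  exact neg_of_mul_neg_right h (mul_pos h1 h2).le

theorem norm_circlePoint (i : Fin n) : ‖circlePoint i‖ = 1 := by
  rw [circlePoint, ← Complex.ofReal_neg, Complex.norm_exp_ofReal_mul_I]

variable {π : DecoratedPerm n}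

theorem norm_le_one_of_mem_chordDiagram {z : ℂ} (hz : z ∈ chordDiagram π) : ‖z‖ ≤ 1 := by
  obtain ⟨i, hi⟩ := mem_iUnion.1 hz
  have := (convex_closedBall (0 : ℂ) 1).segment_subset (x := circlePoint i)
    (y := circlePoint (π.perm i)) (by simp [norm_circlePoint]) (by simp [norm_circlePoint]) hi
  simpa using this

theorem segment_subset_chordDiagram (π : DecoratedPerm n) (i : Fin n) :
    segment ℝ (circlePoint i) (circlePoint (π.perm i)) ⊆ chordDiagram π :=
  subset_iUnion (fun i => segment ℝ (circlePoint i) (circlePoint (π.perm i))) i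

theorem circlePoint_mem_chordDiagram (π : DecoratedPerm n) (i : Fin n) :
    circlePoint i ∈ chordDiagram π :=
  segment_subset_chordDiagram π i (left_mem_segment ℝ _ _)

/-- The relation of lying in the same connected component of the chord diagram, on vertices. -/
def chordSetoid (π : DecoratedPerm n) : Setoid (Fin n) :=
  Setoid.ker fun i => connectedComponentIn (chordDiagram π) (circlePoint i)

theorem mem_connectedComponentIn_iff {i : Fin n} {z : ℂ} :
    circlePoint i ∈ connectedComponentIn (chordDiagram π) z ↔
      connectedComponentIn (chordDiagram π) (circlePoint i) =
        connectedComponentIn (chordDiagram π) z :=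
  ⟨fun h => (connectedComponentIn_eq h).symm,
    fun h => h ▸ mem_connectedComponentIn (circlePoint_mem_chordDiagram π i)⟩

theorem segment_subset_connectedComponentIn {i : Fin n} {z : ℂ}
    (hz : z ∈ segment ℝ (circlePoint i) (circlePoint (π.perm i))) :
    segment ℝ (circlePoint i) (circlePoint (π.perm i)) ⊆
      connectedComponentIn (chordDiagram π) z :=
  (convex_segment _ _).isPreconnected.subset_connectedComponentIn hz
    (segment_subset_chordDiagram π i)

theorem chordBlocks_eq_classes (π : DecoratedPerm n) : chordBlocks π = (chordSetoid π).classes := by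
  ext S
  constructor
  · rintro ⟨x, hx, rfl⟩
    obtain ⟨v, hv⟩ := mem_iUnion.1 hx
    have h := mem_connectedComponentIn_iff.1
      (segment_subset_connectedComponentIn hv (left_mem_segment ℝ _ _))
    refine ⟨v, Set.ext fun i => ?_⟩
    change _ ↔ connectedComponentIn _ _ = connectedComponentIn _ _
    rw [h]
    exact mem_connectedComponentIn_iff
  · rintro ⟨v, rfl⟩
    refine ⟨circlePoint v, circlePoint_mem_chordDiagram π v, Set.ext fun i => ?_⟩
    exact mem_connectedComponentIn_iff.symm

theorem chordSetoid_perm (π : DecoratedPerm n) (i : Fin n) : chordSetoid π (π.perm i) i :=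
  mem_connectedComponentIn_iff.1
    (segment_subset_connectedComponentIn (left_mem_segment ℝ _ _) (right_mem_segment ℝ _ _))

/-- Crossing connected components of the chord diagram meet. If `Y` contains vertices on both sides
of the line through `a` and `c`, it contains a chord that crosses this line, and then `a` and `c` are
on different sides of that chord, so that a connected subset of the disk containing them meets it. -/
theorem isNonCrossingPartition_chordBlocks (π : DecoratedPerm n) :
    IsNonCrossingPartition (chordBlocks π) := by
  rw [chordBlocks_eq_classes]
  refine ⟨Setoid.isPartition_classes _, ?_⟩
  rintro _ ⟨x, rfl⟩ _ ⟨y, rfl⟩ hST ⟨a, b, c, d, hcyc, ha, hc, hb, hd⟩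
  have hxy : ¬ chordSetoid π x y := fun h => hST (Set.ext fun z =>
    ⟨fun hz => (chordSetoid π).trans hz h, fun hz => (chordSetoid π).trans hz ((chordSetoid π).symm h)⟩)
  have hne : ∀ u v, chordSetoid π u x → chordSetoid π v y → u ≠ v := by
    rintro u _ hu hv rfl
    exact hxy ((chordSetoid π).trans ((chordSetoid π).symm hu) hv)
  obtain ⟨z, hzY, hz0⟩ := exists_lineSide_eq_zero_of_isPreconnected
    isPreconnected_connectedComponentIn
    (mem_connectedComponentIn_iff.2 hb) (mem_connectedComponentIn_iff.2 hd)
    ((lineSide_mul_neg_iff a c b d).2 hcyc.chordSide_mul_neg)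
  obtain ⟨v, hv⟩ := mem_iUnion.1 (connectedComponentIn_subset _ _ hzY)
  have hsegY : segment ℝ (circlePoint v) (circlePoint (π.perm v)) ⊆
      connectedComponentIn (chordDiagram π) (circlePoint y) :=
    connectedComponentIn_eq hzY ▸ segment_subset_connectedComponentIn hv
  have hvy : chordSetoid π v y := mem_connectedComponentIn_iff.1 (hsegY (left_mem_segment ℝ _ _))
  have hvy' : chordSetoid π (π.perm v) y :=
    mem_connectedComponentIn_iff.1 (hsegY (right_mem_segment ℝ _ _))
  have hcross : chordSide a c v * chordSide a c (π.perm v) < 0 := by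
    rw [← lineSide_mul_neg_iff]
    refine lt_of_le_of_ne (lineSide_mul_nonpos_of_mem_segment hv hz0) ?_
    obtain ⟨κ₁, h1, e1⟩ := exists_lineSide_eq_chordSide a c v
    obtain ⟨κ₂, h2, e2⟩ := exists_lineSide_eq_chordSide a c (π.perm v)
    rw [e1, e2]
    exact mul_ne_zero
      (mul_ne_zero h1.ne' (chordSide_ne_zero (hne a v ha hvy).symm (hne c v hc hvy).symm))
      (mul_ne_zero h2.ne' (chordSide_ne_zero (hne a _ ha hvy').symm (hne c _ hc hvy').symm))
  have hvv : v ≠ π.perm v := fun h => by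
    rw [← h] at hcross
    exact absurd hcross (not_lt.2 (mul_self_nonneg _))
  rw [chordSide_mul_comm, ← lineSide_mul_neg_iff] at hcross
  obtain ⟨w, hwX, hw0⟩ := exists_lineSide_eq_zero_of_isPreconnected
    isPreconnected_connectedComponentIn
    (mem_connectedComponentIn_iff.2 ha) (mem_connectedComponentIn_iff.2 hc) hcross
  have hsin : Real.sin ((2 * Real.pi * (v : ℝ) / n - 2 * Real.pi * (π.perm v : ℝ) / n) / 2) ≠ 0 := by
    have hb := abs_lt.1 (abs_sub_lt_of_fin v (π.perm v))
    obtain ⟨κ, hκ, e⟩ := exists_sin_eq_mul hb.1 hb.2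
    rw [show (2 * Real.pi * (v : ℝ) / n - 2 * Real.pi * (π.perm v : ℝ) / n) / 2 =
      Real.pi * (v - π.perm v) / n by ring, e]
    refine mul_ne_zero hκ.ne' (sub_ne_zero.2 fun h => hvv (Fin.ext ?_))
    exact_mod_cast h
  have hwY := hsegY (mem_segment_of_lineSide_eq_zero hsin
    (norm_le_one_of_mem_chordDiagram (connectedComponentIn_subset _ _ hwX)) hw0)
  exact hxy ((connectedComponentIn_eq hwX).trans (connectedComponentIn_eq hwY).symm)

/-- A connected component of the chord diagram stays within one block of any non-crossing partition
with `π`-invariant blocks: an interval that is a union of blocks is cut off by a line through the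
midpoints of two arcs between neighbouring vertices, and this line meets no chord. -/
theorem chordBlocks_refines {P : Set (Set (Fin n))} (hP : IsNonCrossingPartition P)
    (hπ : ∀ i : Fin n, ∃ S ∈ P, i ∈ S ∧ π.perm i ∈ S) : Refines (chordBlocks π) P := by
  rw [chordBlocks_eq_classes]
  rintro S ⟨i, rfl⟩
  obtain ⟨T, hT, hi, -⟩ := hπ i
  refine ⟨T, hT, fun j hj => ?_⟩
  by_contra hjT
  obtain ⟨a, k, hak, hinv, hsep⟩ := hP.exists_Icc hT hi hjT
  set α : ℝ := 2 * Real.pi * ((a : ℝ) - 1 / 2) / n with hα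
  set β : ℝ := 2 * Real.pi * ((k : ℝ) + 1 / 2) / n with hβ
  have hside : ∀ x : Fin n, (x ∈ Icc a k → lineSide α β (circlePoint x) < 0) ∧
      (x ∉ Icc a k → 0 < lineSide α β (circlePoint x)) := by
    intro x
    have hx1 : (x : ℝ) + 1 ≤ n := by exact_mod_cast x.2
    have ha1 : (a : ℝ) + 1 ≤ n := by exact_mod_cast a.2
    have hk1 : (k : ℝ) + 1 ≤ n := by exact_mod_cast k.2
    have hx0 : (0 : ℝ) ≤ (x : ℝ) := Nat.cast_nonneg _
    have ha0 : (0 : ℝ) ≤ (a : ℝ) := Nat.cast_nonneg _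
    have hk0 : (0 : ℝ) ≤ (k : ℝ) := Nat.cast_nonneg _
    obtain ⟨κ, hκ, e⟩ := exists_lineSide_circlePoint x (s := (a : ℝ) - 1 / 2)
      (t := (k : ℝ) + 1 / 2) (by rw [abs_lt]; constructor <;> linarith)
      (by rw [abs_lt]; constructor <;> linarith)
    rw [hα, hβ, e]
    constructor
    · rintro ⟨h1, h2⟩
      have h1' : (a : ℝ) ≤ x := by exact_mod_cast h1
      have h2' : (x : ℝ) ≤ k := by exact_mod_cast h2
      exact mul_neg_of_pos_of_neg hκ (mul_neg_of_pos_of_neg (by linarith) (by linarith))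
    · intro h
      refine mul_pos hκ ?_
      have hak' : (a : ℝ) ≤ k := by exact_mod_cast hak
      rw [mem_Icc, not_and_or, not_le, not_le] at h
      rcases h with h | h
      · have h' : (x : ℝ) + 1 ≤ a := by exact_mod_cast h
        exact mul_pos_of_neg_of_neg (by linarith) (by linarith)
      · have h' : (k : ℝ) + 1 ≤ x := by exact_mod_cast h
        exact mul_pos (by linarith) (by linarith)
  have hneg : lineSide α β (circlePoint i) * lineSide α β (circlePoint j) < 0 := by
    by_cases hiI : i ∈ Icc a k <;> by_cases hjI : j ∈ Icc a k
    · exact absurd (iff_of_true hiI hjI) hsep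
    · exact mul_neg_of_neg_of_pos ((hside i).1 hiI) ((hside j).2 hjI)
    · exact mul_neg_of_pos_of_neg ((hside i).2 hiI) ((hside j).1 hjI)
    · exact absurd (iff_of_false hiI hjI) hsep
  obtain ⟨z, hz, hz0⟩ := exists_lineSide_eq_zero_of_isPreconnected
    isPreconnected_connectedComponentIn
    (mem_connectedComponentIn (circlePoint_mem_chordDiagram π i))
    (mem_connectedComponentIn_iff.2 hj) hneg
  obtain ⟨v, hv⟩ := mem_iUnion.1 (connectedComponentIn_subset _ _ hz)
  refine absurd (lineSide_mul_nonpos_of_mem_segment hv hz0) (not_le.2 ?_)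
  obtain ⟨U, hU, hvU, hvU'⟩ := hπ v
  by_cases hvI : v ∈ Icc a k
  · exact mul_pos_of_neg_of_neg ((hside v).1 hvI)
      ((hside _).1 (hinv U hU v hvU _ hvU' hvI))
  · exact mul_pos ((hside v).2 hvI)
      ((hside _).2 fun h => hvI (hinv U hU _ hvU' v hvU h))

end Chord

theorem Refines.eq_of_isPartition {α : Type*} {P Q : Set (Set α)} (hP : Setoid.IsPartition P)
    (hQ : Setoid.IsPartition Q) (h : Refines P Q) (h' : Refines Q P) : P = Q := by
  have key : ∀ {P Q : Set (Set α)}, Setoid.IsPartition P → Refines P Q → Refines Q P → P ⊆ Q := by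
    intro P Q hP h h' S hS
    obtain ⟨T, hT, hST⟩ := h S hS
    obtain ⟨S', hS', hTS'⟩ := h' T hT
    obtain ⟨x, hx⟩ := nonempty_iff_ne_empty.2 fun h0 => hP.1 (h0 ▸ hS)
    obtain rfl : S = S' := (hP.2 x).unique ⟨hS, hx⟩ ⟨hS', hTS' (hST hx)⟩
    rwa [hST.antisymm hTS']
  exact (key hP h h').antisymm (key hQ h' h)

end Positroid

theorem mainTheorem8 {n : ℕ} (M : Matroid (Fin n)) (hM : Positroid.IsPositroid M) :
    (Positroid.IsNonCrossingPartition (Positroid.componentBlocks M) ∧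
      (∀ i : Fin n, ∃ S ∈ Positroid.componentBlocks M,
        i ∈ S ∧ (Positroid.decoratedPerm M).perm i ∈ S) ∧
      (∀ P : Set (Set (Fin n)), Positroid.IsNonCrossingPartition P →
        (∀ i : Fin n, ∃ S ∈ P, i ∈ S ∧ (Positroid.decoratedPerm M).perm i ∈ S) →
        Positroid.Refines (Positroid.componentBlocks M) P)) ∧
    Positroid.componentBlocks M = Positroid.chordBlocks (Positroid.decoratedPerm M) := by
  have hE : M.E = univ := by
    obtain ⟨d, A, -, hMA⟩ := hM
    exact hMA.1
  have hnc := Positroid.isNonCrossingPartition_componentBlocks hM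
  have hπ : ∀ i : Fin n, ∃ S ∈ Positroid.componentBlocks M,
      i ∈ S ∧ (Positroid.decoratedPerm M).perm i ∈ S := by
    intro i
    rw [Positroid.componentBlocks_eq_classes hE]
    exact ⟨_, ⟨i, rfl⟩, (Positroid.compSetoid M).refl i,
      (Positroid.compSetoid M).symm (Positroid.compSetoid_perm hE i)⟩
  have hchord := Positroid.isNonCrossingPartition_chordBlocks (Positroid.decoratedPerm M)
  refine ⟨⟨hnc, hπ, fun P hP h => Positroid.componentBlocks_refines hE hP h⟩, ?_⟩
  refine Positroid.Refines.eq_of_isPartition hnc.1 hchord.1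
    (Positroid.componentBlocks_refines hE hchord fun i => ?_)
    (Positroid.chordBlocks_refines hnc hπ)
  rw [Positroid.chordBlocks_eq_classes]
  exact ⟨_, ⟨i, rfl⟩, (Positroid.chordSetoid _).refl i, Positroid.chordSetoid_perm _ i⟩
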